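/- Let $K$ be an algebraically closed field of characteristic $0$, let $Z\subset\mathbb{P}^2_K$ be a non-empty finite set of points, and let $I=\bigcap_{P\in Z}I(P)\subset K[x_0,x_1,x_2]$ be its radical ideal, where $I(P)$ is the ideal generated by the forms vanishing at $P$. For $m\ge 1$ let $I^{(m)}=\bigcap_{P\in Z}I(P)^m$ be the $m$-th symbolic power, let $\alpha(J)$ denote the least degree of a nonzero form in a homogeneous ideal $J$, and let $$\widehat\alpha(I)=\lim_{m\to\infty}\frac{\alpha(I^{(m)})}{m}=\inf_{m\ge 1}\frac{\alpha(I^{(m)})}{m}$$ be the Waldschmidt constant. A $4$-star is the set of all intersection points of four distinct lines, no three of which are concurrent. A $3$-quasi star is the set consisting of the three vertices of a triangle (three distinct non-concurrent lines) together with exactly one further point, different from the vertices, on each of its three lines, where the three further points are not collinear. A conic is the zero set of a nonzero quadratic form. **Main Theorem.** If $\widehat\alpha(I)<\frac94$, then $Z$ is contained in a line, or $Z$ is contained in a conic, or $Z$ is a $4$-star with $|Z|=6$. Here $\widehat\alpha(I)=1$ whenever $Z$ is contained in a line, $\widehat\alpha(I)\le 2$ whenever $Z$ is contained in a conic, and $\widehat\alpha(I)=2$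 and $|Z|=6$ whenever $Z$ is a $4$-star. Moreover, if $\alpha(I^{(m)})/m=\frac94$ for some $m\ge 1$, then $Z$ is a $3$-quasi star. -/

import Mathlib

open scoped LinearAlgebra.Projectivization

noncomputable section

namespace PlanarPoints

variable {K : Type*} [Field K]

/-- The projective plane over `K`. -/
abbrev Plane (K : Type*) [Field K] : Type _ := ℙ K (Fin 3 → K)

/-- The point `P` lies on the line `a₀x₀ + a₁x₁ + a₂x₂ = 0`, where the line is given by the point
`ℓ = [a₀ : a₁ : a₂]` of the dual plane. -/
def OnLine (P ℓ : Plane K) : Prop := P.orthogonal ℓ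

/-- The ideal `I(P)` of `K[x₀, x₁, x₂]` generated by all forms that vanish at `P`
(for a form this does not depend on the choice of the coordinate vector). -/
def pointIdeal (P : Plane K) : Ideal (MvPolynomial (Fin 3) K) :=
  Ideal.span {F | (∃ d : ℕ, F.IsHomogeneous d) ∧ MvPolynomial.eval P.rep F = 0}

/-- The symbolic power `I^(m) = ⋂ I(P)^m` (`P ∈ Z`) of the radical ideal `I = ⋂ I(P)` of `Z`. -/
def symbolicPower (Z : Finset (Plane K)) (m : ℕ) : Ideal (MvPolynomial (Fin 3) K) :=
  ⨅ P ∈ Z, pointIdeal P ^ m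

/-- The initial degree `α(J)` of a homogeneous ideal: the least `d` with `J_d ≠ 0`. -/
def initialDegree (J : Ideal (MvPolynomial (Fin 3) K)) : ℕ :=
  sInf {d : ℕ | ∃ F ∈ J, F ≠ 0 ∧ F.IsHomogeneous d}

/-- The Waldschmidt constant `inf_{m ≥ 1} α(I^(m)) / m` of the radical ideal `I` of `Z`.
It is also the limit of `α(I^(m)) / m`, see `tendsto_waldschmidt`. -/
def waldschmidt (Z : Finset (Plane K)) : ℝ :=
  sInf ((fun m : ℕ => (initialDegree (symbolicPower Z m) : ℝ) / m) '' Set.Ici 1)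

/-- `Z` is contained in a line. -/
def InLine (Z : Finset (Plane K)) : Prop :=
  ∃ ℓ : Plane K, ∀ P ∈ Z, OnLine P ℓ

/-- `Z` is contained in a conic, i.e. in the zero set of a nonzero quadratic form. -/
def InConic (Z : Finset (Plane K)) : Prop :=
  ∃ F : MvPolynomial (Fin 3) K, F ≠ 0 ∧ F.IsHomogeneous 2 ∧ ∀ P ∈ Z, MvPolynomial.eval P.rep F = 0

/-- Lines in general position: pairwise distinct, and no three of them meet in a point. -/
def GeneralLines {d : ℕ} (L : Fin d → Plane K) : Prop :=
  Function.Injective L ∧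
    ∀ i j k : Fin d, i ≠ j → i ≠ k → j ≠ k →
      ¬ ∃ P : Plane K, OnLine P (L i) ∧ OnLine P (L j) ∧ OnLine P (L k)

/-- `P` is an intersection point of two of the lines `L`. -/
def IsCrossing {d : ℕ} (L : Fin d → Plane K) (P : Plane K) : Prop :=
  ∃ i j : Fin d, i ≠ j ∧ OnLine P (L i) ∧ OnLine P (L j)

/-- A `d`-star: all the intersection points of `d` general lines. -/
def IsStar (d : ℕ) (Z : Finset (Plane K)) : Prop :=
  ∃ L : Fin d → Plane K, GeneralLines L ∧ ∀ P : Plane K, P ∈ Z ↔ IsCrossing L P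

/-- A `d`-quasi star: all the intersection points of `d` general lines `L i`, together with exactly
one more point `Q i` on each of these lines, where the points `Q i` are not collinear. -/
def IsQuasiStar (d : ℕ) (Z : Finset (Plane K)) : Prop :=
  ∃ L Q : Fin d → Plane K, GeneralLines L ∧
    (∀ i, OnLine (Q i) (L i) ∧ ¬ IsCrossing L (Q i)) ∧
    (¬ ∃ ℓ : Plane K, ∀ i, OnLine (Q i) ℓ) ∧
    ∀ P : Plane K, P ∈ Z ↔ IsCrossing L P ∨ ∃ i, P = Q i

/-! The infimum in the definition of the Waldschmidt constant is the limit. -/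

theorem exists_linear_form (P : Plane K) :
    ∃ F : MvPolynomial (Fin 3) K, F ≠ 0 ∧ F.IsHomogeneous 1 ∧ F ∈ pointIdeal P := by
  suffices h : ∃ F : MvPolynomial (Fin 3) K, F ≠ 0 ∧ F.IsHomogeneous 1 ∧
      MvPolynomial.eval P.rep F = 0 by
    obtain ⟨F, h0, h1, h2⟩ := h
    exact ⟨F, h0, h1, Ideal.subset_span ⟨⟨1, h1⟩, h2⟩⟩
  by_cases h : P.rep 0 = 0
  · exact ⟨MvPolynomial.X 0, MvPolynomial.X_ne_zero 0, MvPolynomial.isHomogeneous_X K 0,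
      by simpa using h⟩
  · refine ⟨MvPolynomial.C (P.rep 1) * MvPolynomial.X 0
      - MvPolynomial.C (P.rep 0) * MvPolynomial.X 1, ?_, ?_, ?_⟩
    · intro h0
      have := congrArg (MvPolynomial.eval ![(0 : K), 1, 0]) h0
      simp at this
      exact h this
    · exact ((MvPolynomial.isHomogeneous_X K 0).C_mul _).sub
        ((MvPolynomial.isHomogeneous_X K 1).C_mul _)
    · simp [mul_comm]

theorem exists_form_symbolicPower (Z : Finset (Plane K)) (m : ℕ) :
    ∃ d : ℕ, ∃ F ∈ symbolicPower Z m, F ≠ 0 ∧ F.IsHomogeneous d := by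
  choose f h0 h1 h2 using exists_linear_form (K := K)
  refine ⟨_, (∏ P ∈ Z, f P) ^ m, ?_, pow_ne_zero _ (Finset.prod_ne_zero_iff.2 fun P _ => h0 P),
    (MvPolynomial.IsHomogeneous.prod Z f (fun _ => 1) fun P _ => h1 P).pow m⟩
  simp only [symbolicPower, Ideal.mem_iInf]
  intro P hP
  exact Ideal.pow_mem_pow (Ideal.mem_of_dvd _ (Finset.dvd_prod_of_mem f hP) (h2 P)) m

theorem initialDegree_spec (Z : Finset (Plane K)) (m : ℕ) :
    ∃ F ∈ symbolicPower Z m, F ≠ 0 ∧ F.IsHomogeneous (initialDegree (symbolicPower Z m)) :=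
  Nat.sInf_mem (s := {d : ℕ | ∃ F ∈ symbolicPower Z m, F ≠ 0 ∧ F.IsHomogeneous d})
    (exists_form_symbolicPower Z m)

theorem subadditive_initialDegree (Z : Finset (Plane K)) :
    Subadditive fun m : ℕ => (initialDegree (symbolicPower Z m) : ℝ) := by
  intro m n
  obtain ⟨F, hF, hF0, hFd⟩ := initialDegree_spec Z m
  obtain ⟨G, hG, hG0, hGd⟩ := initialDegree_spec Z n
  have h : initialDegree (symbolicPower Z (m + n)) ≤
      initialDegree (symbolicPower Z m) + initialDegree (symbolicPower Z n) := by
    refine Nat.sInf_le ⟨F * G, ?_, mul_ne_zero hF0 hG0, hFd.mul hGd⟩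
    simp only [symbolicPower, Ideal.mem_iInf] at hF hG ⊢
    intro P hP
    rw [pow_add]
    exact Ideal.mul_mem_mul (hF P hP) (hG P hP)
  dsimp only
  exact_mod_cast h

theorem tendsto_waldschmidt (Z : Finset (Plane K)) :
    Filter.Tendsto (fun m : ℕ => (initialDegree (symbolicPower Z m) : ℝ) / m) Filter.atTop
      (nhds (waldschmidt Z)) := by
  have hb : BddBelow
      (Set.range fun m : ℕ => (initialDegree (symbolicPower Z m) : ℝ) / m) := by
    refine ⟨0, ?_⟩
    rintro _ ⟨m, rfl⟩
    positivity
  simpa only [Subadditive.lim, waldschmidt] using (subadditive_initialDegree Z).tendsto_lim hb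

end PlanarPoints

end

/-!
Suppose that `Z` is not contained in a conic. All of the lower bounds on the degree `d` of a form
`F` vanishing to order `m` at the points of `Z` have the same shape: weights `w i` on some points
`P i` of `Z` and a constant `c` with `∑ w i * ord (P i) F ≤ c * d` for *every* nonzero form `F`
(`sum_mul_ord_le`). Such an inequality is proved by splitting off from `F` the lines and conics of
a finite list of test curves. The inequality is checked directly for each test curve. A form that
contains none of them satisfies the Bézout inequality with each, and the claimed inequality is a
linear consequence of these and of `ord ≤ d`. In other words, the weights are a feasible point of a
linear program, and the argument says that a suitable divisor is nef. Only lines and conics through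
five points in general position occur. Both can be parametrised, so that Bézout reduces to counting
the zeros of the pull-back of `F`, a polynomial in one variable (`aeval_eq_zero_of_lt_sum_ord`),
together with the fact that a form vanishing on a parametrised line or conic is divisible by its
equation. The multiplicity `ord` is defined by the Taylor expansion.

Since the points of `Z` impose six independent conditions on quadratic forms, `Z` has six points
that do not lie on a conic (`exists_offConic`). These are classified by the lines that contain
three of them (`outcome_of_offConic`). No two triples of collinear points are complementary, as two
lines would form a conic. If there is no such line, or one, or two, then a conic through five of
the points and a line through the sixth give the bound `7 / 3` (`degreeBound_conic`). Three lines
form a triangle that contains all of the points: they are a quasi star, or the points other than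
the vertices lie on a fourth line and form a star with it.

A quasi star gives the bound `9 / 4`, and a star gives `2`. A further point `x` of `Z` improves
these bounds to at least `145 / 64 > 9 / 4`: for a quasi star, `x` misses enough of the three lines
and of the three lines joining the points `q i` (`IsQuasiStarIn.degreeBound_of_mem`); for a star,
either `x` lies on none of the four lines, which gives `7 / 3`, or replacing a point of the star by
`x` gives a quasi star, and the replaced point is a further point (`IsStarIn.degreeBound_of_mem`).
So the Waldschmidt constant of `Z` exceeds `9 / 4`, or `Z` is a quasi star with constant at least
`9 / 4`, or `Z` is a star (`degreeBound_or_isQuasiStar_or_isStar`). When `α(I^(m)) / m = 9 / 4`, a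
star is excluded because `4` divides `m`, and the powers of the product of its lines show that
`α(I^(m)) ≤ 2 m`.
-/

open scoped LinearAlgebra.Projectivization

noncomputable section

namespace PlanarPoints

variable {K : Type*} [Field K]

open Matrix

/-! ### Multiplicities and parametrised curves -/

/-- The Taylor expansion `F(p + t x)` of `F` at the vector `p`, as a polynomial in `t` whose
coefficients are polynomials in `x`. -/
def taylorAt (p : Fin 3 → K) :
    MvPolynomial (Fin 3) K →ₐ[K] Polynomial (MvPolynomial (Fin 3) K) :=
  MvPolynomial.aeval fun i =>
    Polynomial.C (MvPolynomial.C (p i)) + Polynomial.X * Polynomial.C (MvPolynomial.X i)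

/-- The multiplicity of `F` at the vector `p`: the order of vanishing of `F(p + t x)` at `t = 0`
(and `0` if `F = 0`). For a form `F` and `p ≠ 0` this is the multiplicity of the curve `F = 0` at
the point `[p]`. -/
def ord (p : Fin 3 → K) (F : MvPolynomial (Fin 3) K) : ℕ := (taylorAt p F).natTrailingDegree

theorem taylorAt_injective (p : Fin 3 → K) : Function.Injective (taylorAt p) := by
  -- setting `t = 1` and replacing `x` by `x - p` recovers `F`
  let ψ : Polynomial (MvPolynomial (Fin 3) K) →ₐ[K] MvPolynomial (Fin 3) K :=
    (MvPolynomial.aeval fun i => MvPolynomial.X i - MvPolynomial.C (p i)).comp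
      ((Polynomial.aeval (1 : MvPolynomial (Fin 3) K)).restrictScalars K)
  have h : ψ.comp (taylorAt p) = AlgHom.id K _ := by
    ext i
    simp [ψ, taylorAt, ← MvPolynomial.algebraMap_eq]
  exact Function.LeftInverse.injective (g := ψ) fun F => DFunLike.congr_fun h F

theorem taylorAt_ne_zero (p : Fin 3 → K) {F : MvPolynomial (Fin 3) K} (hF : F ≠ 0) :
    taylorAt p F ≠ 0 :=
  (map_ne_zero_iff _ (taylorAt_injective p)).2 hF

theorem ord_mul (p : Fin 3 → K) {F G : MvPolynomial (Fin 3) K} (hF : F ≠ 0) (hG : G ≠ 0) :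
    ord p (F * G) = ord p F + ord p G := by
  rw [ord, map_mul, Polynomial.natTrailingDegree_mul (taylorAt_ne_zero p hF)
    (taylorAt_ne_zero p hG), ord, ord]

theorem X_pow_dvd_taylorAt (p : Fin 3 → K) (F : MvPolynomial (Fin 3) K) :
    Polynomial.X ^ ord p F ∣ taylorAt p F :=
  Polynomial.X_pow_dvd_iff.2 fun _ hd => Polynomial.coeff_eq_zero_of_lt_natTrailingDegree hd

theorem le_ord_of_dvd {p : Fin 3 → K} {F : MvPolynomial (Fin 3) K} (hF : F ≠ 0) {m : ℕ}
    (h : Polynomial.X ^ m ∣ taylorAt p F) : m ≤ ord p F :=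
  Polynomial.le_natTrailingDegree (taylorAt_ne_zero p hF) (Polynomial.X_pow_dvd_iff.1 h)

theorem X_dvd_taylorAt_iff {p : Fin 3 → K} {F : MvPolynomial (Fin 3) K} :
    Polynomial.X ∣ taylorAt p F ↔ MvPolynomial.eval p F = 0 := by
  rw [Polynomial.X_dvd_iff]
  let ψ : Polynomial (MvPolynomial (Fin 3) K) →ₐ[K] MvPolynomial (Fin 3) K :=
    (Polynomial.aeval (0 : MvPolynomial (Fin 3) K)).restrictScalars K
  have h1 : ψ.comp (taylorAt p) = MvPolynomial.aeval fun i => MvPolynomial.C (p i) := by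
    ext i
    simp [ψ, taylorAt]
  have h2 : ψ (taylorAt p F) = MvPolynomial.C (MvPolynomial.eval p F) := by
    rw [← AlgHom.comp_apply, h1, ← MvPolynomial.algebraMap_eq, ← MvPolynomial.coe_aeval_eq_eval]
    exact MvPolynomial.aeval_algebraMap_apply _ p F
  rw [Polynomial.coeff_zero_eq_aeval_zero]
  have h3 : Polynomial.aeval 0 (taylorAt p F) = ψ (taylorAt p F) := rfl
  rw [h3, h2, MvPolynomial.C_eq_zero]

theorem ord_eq_zero {p : Fin 3 → K} {F : MvPolynomial (Fin 3) K}
    (h : MvPolynomial.eval p F ≠ 0) : ord p F = 0 := by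
  by_contra h0
  exact h (X_dvd_taylorAt_iff.1 ((dvd_pow_self _ h0).trans (X_pow_dvd_taylorAt p F)))

theorem le_ord_of_mem_pow {P : Plane K} {F : MvPolynomial (Fin 3) K} (hF : F ≠ 0) {m : ℕ}
    (h : F ∈ pointIdeal P ^ m) : m ≤ ord P.rep F := by
  refine le_ord_of_dvd hF ?_
  have h1 : (pointIdeal P).map (taylorAt P.rep) ≤ Ideal.span {Polynomial.X} := by
    rw [pointIdeal, Ideal.map_span, Ideal.span_le]
    rintro _ ⟨G, ⟨-, hG⟩, rfl⟩
    exact Ideal.mem_span_singleton.2 (X_dvd_taylorAt_iff.2 hG)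
  have h2 := Ideal.mem_map_of_mem (taylorAt P.rep) h
  rw [Ideal.map_pow] at h2
  have h3 := Ideal.pow_right_mono h1 m h2
  rwa [Ideal.span_singleton_pow, Ideal.mem_span_singleton] at h3

theorem le_ord_of_mem_symbolicPower {Z : Finset (Plane K)} {P : Plane K} (hP : P ∈ Z)
    {F : MvPolynomial (Fin 3) K} (hF : F ≠ 0) {m : ℕ} (h : F ∈ symbolicPower Z m) :
    m ≤ ord P.rep F := by
  simp only [symbolicPower, Ideal.mem_iInf] at h
  exact le_ord_of_mem_pow hF (h P hP)

theorem ord_le_of_isHomogeneous (p : Fin 3 → K) {F : MvPolynomial (Fin 3) K} {d : ℕ}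
    (hd : F.IsHomogeneous d) : ord p F ≤ d := by
  refine (Polynomial.natTrailingDegree_le_natDegree _).trans ?_
  have := MvPolynomial.aeval_natDegree_le (m := d) (n := 1)
    (MvPolynomial.map (algebraMap K (MvPolynomial (Fin 3) K)) F)
    (hd.map _).totalDegree_le
    (fun i => Polynomial.C (MvPolynomial.C (p i)) +
      Polynomial.X * Polynomial.C (MvPolynomial.X i : MvPolynomial (Fin 3) K))
    (fun i => by compute_degree)
  rwa [MvPolynomial.aeval_map_algebraMap, mul_one] at this

/-- A form of degree `d` is multiplied by `r ^ d` when its arguments are multiplied by `r`. -/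
theorem aeval_mul_of_isHomogeneous {A : Type*} [CommRing A] [Algebra K A]
    {F : MvPolynomial (Fin 3) K} {d : ℕ} (hd : F.IsHomogeneous d) (r : A) (g : Fin 3 → A) :
    MvPolynomial.aeval (fun i => r * g i) F = r ^ d * MvPolynomial.aeval g F := by
  rw [MvPolynomial.aeval_def, MvPolynomial.aeval_def, MvPolynomial.eval₂_eq,
    MvPolynomial.eval₂_eq, Finset.mul_sum]
  refine Finset.sum_congr rfl fun m hm => ?_
  simp only [mul_pow, Finset.prod_mul_distrib]
  rw [Finset.prod_pow_eq_pow_sum, hd.degree_eq_sum_deg_support hm]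
  ring

theorem eval_smul_of_isHomogeneous {F : MvPolynomial (Fin 3) K} {d : ℕ} (hd : F.IsHomogeneous d)
    (r : K) (p : Fin 3 → K) :
    MvPolynomial.eval (r • p) F = r ^ d * MvPolynomial.eval p F := by
  simpa [Pi.smul_def] using aeval_mul_of_isHomogeneous hd r p

/-- A curve germ through `p` meets `F` to order at least the multiplicity of `F` at `p`. -/
theorem X_sub_C_pow_ord_dvd {γ : Fin 3 → Polynomial K} {p : Fin 3 → K} {s : K}
    (h : ∀ i, (γ i).eval s = p i) (F : MvPolynomial (Fin 3) K) :
    (Polynomial.X - Polynomial.C s) ^ ord p F ∣ MvPolynomial.aeval γ F := by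
  choose η hη using fun i => Polynomial.X_sub_C_dvd_sub_C_eval (p := γ i) (a := s)
  let ψ : Polynomial (MvPolynomial (Fin 3) K) →+* Polynomial K :=
    Polynomial.eval₂RingHom (MvPolynomial.aeval η : MvPolynomial (Fin 3) K →ₐ[K] _).toRingHom
      (Polynomial.X - Polynomial.C s)
  have h1 : ψ (taylorAt p F) = MvPolynomial.aeval γ F := by
    have : ψ.comp (taylorAt p).toRingHom
        = (MvPolynomial.aeval γ : MvPolynomial (Fin 3) K →ₐ[K] _).toRingHom := by
      refine MvPolynomial.ringHom_ext (fun a => ?_) fun i => ?_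
      · simp [ψ, taylorAt, Polynomial.algebraMap_apply, MvPolynomial.algebraMap_eq]
      · have := hη i
        rw [h] at this
        simp [ψ, taylorAt]
        rw [mul_comm, ← this]
        ring
    exact DFunLike.congr_fun this F
  rw [← h1]
  have := map_dvd ψ (X_pow_dvd_taylorAt p F)
  simpa [ψ] using this

/-- The version of `X_sub_C_pow_ord_dvd` for forms, where the germ passes through a multiple of
`p`. -/
theorem X_sub_C_pow_ord_dvd_of_isHomogeneous {γ : Fin 3 → Polynomial K} {p : Fin 3 → K} {s c : K}
    (hc : c ≠ 0) (h : ∀ i, (γ i).eval s = c * p i) {F : MvPolynomial (Fin 3) K} {d : ℕ}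
    (hd : F.IsHomogeneous d) :
    (Polynomial.X - Polynomial.C s) ^ ord p F ∣ MvPolynomial.aeval γ F := by
  have h1 := X_sub_C_pow_ord_dvd (γ := fun i => Polynomial.C c⁻¹ * γ i) (p := p) (s := s)
    (fun i => by simp [h, hc]) F
  rw [aeval_mul_of_isHomogeneous hd] at h1
  have hu : IsUnit (Polynomial.C c⁻¹ ^ d : Polynomial K) :=
    (Polynomial.isUnit_C.2 (isUnit_iff_ne_zero.2 (inv_ne_zero hc))).pow d
  exact (hu.dvd_mul_left).1 h1

/-- If a parametrised curve of degree `e` passes through points at which the form `F` of degree `d`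
has multiplicities summing up to more than `e * d`, then `F` vanishes on the curve. -/
theorem aeval_eq_zero_of_lt_sum_ord {ι : Type*} {e : ℕ} {γ : Fin 3 → Polynomial K}
    (hγ : ∀ i, (γ i).natDegree ≤ e) (p : ι → Fin 3 → K) (S : Finset ι) {s c : ι → K}
    (hs : Set.InjOn s S) (hc : ∀ i ∈ S, c i ≠ 0)
    (h : ∀ i ∈ S, ∀ j, (γ j).eval (s i) = c i * p i j)
    {F : MvPolynomial (Fin 3) K} {d : ℕ} (hd : F.IsHomogeneous d)
    (hlt : e * d < ∑ i ∈ S, ord (p i) F) : MvPolynomial.aeval γ F = 0 := by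
  have hdvd : ∏ i ∈ S, (Polynomial.X - Polynomial.C (s i)) ^ ord (p i) F
      ∣ MvPolynomial.aeval γ F := by
    refine Finset.prod_dvd_of_coprime ?_ fun i hi =>
      X_sub_C_pow_ord_dvd_of_isHomogeneous (hc i hi) (h i hi) hd
    intro i hi j hj hij
    exact (Polynomial.isCoprime_X_sub_C_of_isUnit_sub
      (sub_ne_zero.2 fun hh => hij (hs hi hj hh)).isUnit).pow
  refine Polynomial.eq_zero_of_dvd_of_natDegree_lt hdvd ?_
  have h1 : (MvPolynomial.aeval γ F).natDegree ≤ d * e :=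
    MvPolynomial.aeval_natDegree_le F hd.totalDegree_le γ hγ
  rw [Polynomial.natDegree_prod_of_monic _ _
    fun i _ => (Polynomial.monic_X_sub_C _).pow _]
  simp only [Polynomial.natDegree_pow, Polynomial.natDegree_X_sub_C, mul_one]
  rw [mul_comm] at hlt
  omega

/-! ### Linear substitutions, and equations of lines and conics -/

/-- The linear change of variables `x ↦ B x`. -/
def subst (B : Matrix (Fin 3) (Fin 3) K) :
    MvPolynomial (Fin 3) K →ₐ[K] MvPolynomial (Fin 3) K :=
  MvPolynomial.aeval (B.map MvPolynomial.C *ᵥ MvPolynomial.X)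

theorem aeval_subst {A : Type*} [CommRing A] [Algebra K A] (B : Matrix (Fin 3) (Fin 3) K)
    (g : Fin 3 → A) (F : MvPolynomial (Fin 3) K) :
    MvPolynomial.aeval g (subst B F) =
      MvPolynomial.aeval (B.map (algebraMap K A) *ᵥ g) F := by
  rw [subst, ← AlgHom.comp_apply]
  congr 1
  ext i
  simp [mulVec, dotProduct]

theorem eval_subst (B : Matrix (Fin 3) (Fin 3) K) (x : Fin 3 → K) (F : MvPolynomial (Fin 3) K) :
    MvPolynomial.eval x (subst B F) = MvPolynomial.eval (B *ᵥ x) F := by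
  simpa [MvPolynomial.aeval_eq_eval] using aeval_subst B x F

theorem subst_subst_of_mul_eq_one {A B : Matrix (Fin 3) (Fin 3) K} (h : B * A = 1)
    (F : MvPolynomial (Fin 3) K) : subst A (subst B F) = F := by
  conv_lhs => rw [subst]
  rw [aeval_subst, MvPolynomial.algebraMap_eq, mulVec_mulVec]
  rw [← RingHom.coe_coe (MvPolynomial.C), ← Matrix.map_mul, h,
    Matrix.map_one _ (map_zero _) (map_one _), one_mulVec]
  exact MvPolynomial.aeval_X_left_apply F

theorem isHomogeneous_subst (B : Matrix (Fin 3) (Fin 3) K) {F : MvPolynomial (Fin 3) K} {d : ℕ}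
    (hd : F.IsHomogeneous d) : (subst B F).IsHomogeneous d := by
  have := hd.aeval (B.map MvPolynomial.C *ᵥ MvPolynomial.X) (n := 1) fun i =>
    MvPolynomial.IsHomogeneous.sum _ _ _ fun j _ => MvPolynomial.isHomogeneous_C_mul_X _ _
  rwa [one_mul] at this

/-- A form vanishing on the line `y₀ = 0` is divisible by `y₀`. -/
theorem X_dvd_of_eval_eq_zero [Infinite K] {G : MvPolynomial (Fin 3) K} {d : ℕ}
    (hd : G.IsHomogeneous d) (h : ∀ s : K, MvPolynomial.eval ![0, 1, s] G = 0) :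
    MvPolynomial.X 0 ∣ G := by
  rw [← map_dvd_iff (MvPolynomial.finSuccEquiv K 2), MvPolynomial.finSuccEquiv_X_zero,
    Polynomial.X_dvd_iff]
  -- the point at infinity of the line is not among the given zeros, hence the factor `y₁`
  suffices h0 : MvPolynomial.X 0 * (MvPolynomial.finSuccEquiv K 2 G).coeff 0 = 0 from
    (mul_eq_zero.1 h0).resolve_left (MvPolynomial.X_ne_zero 0)
  refine MvPolynomial.funext fun x => ?_
  rw [map_mul, map_zero, MvPolynomial.eval_X]
  by_cases hx : x 0 = 0
  · rw [hx, zero_mul]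
  have h1 := MvPolynomial.eval_eq_eval_mv_eval' x 0 G
  rw [← Polynomial.coeff_zero_eq_eval_zero, Polynomial.coeff_map] at h1
  have h2 : (Fin.cons 0 x : Fin 3 → K) = x 0 • ![0, 1, x 1 / x 0] := by
    ext i
    fin_cases i
    · simp
    · simp
    · exact (mul_div_cancel₀ (x 1) hx).symm
  rw [h2, eval_smul_of_isHomogeneous hd, h, mul_zero] at h1
  rw [← h1, mul_zero]

/-- A form vanishing on the conic `y₀² = y₁ y₂` is divisible by its equation. -/
theorem conic_dvd_of_eval_eq_zero [IsAlgClosed K] [CharZero K] {G : MvPolynomial (Fin 3) K}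
    {d : ℕ} (hd : G.IsHomogeneous d) (h : ∀ s : K, MvPolynomial.eval ![s, 1, s ^ 2] G = 0) :
    MvPolynomial.X 0 ^ 2 - MvPolynomial.X 1 * MvPolynomial.X 2 ∣ G := by
  rw [← map_dvd_iff (MvPolynomial.finSuccEquiv K 2)]
  set P := MvPolynomial.finSuccEquiv K 2 G with hP
  set q : Polynomial (MvPolynomial (Fin 2) K) :=
    Polynomial.X ^ 2 - Polynomial.C (MvPolynomial.X 0 * MvPolynomial.X 1) with hq
  have hq1 : MvPolynomial.finSuccEquiv K 2
      (MvPolynomial.X 0 ^ 2 - MvPolynomial.X 1 * MvPolynomial.X 2) = q := by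
    rw [show (1 : Fin 3) = Fin.succ 0 from rfl, show (2 : Fin 3) = Fin.succ 1 from rfl, map_sub,
      map_pow, map_mul, MvPolynomial.finSuccEquiv_X_zero, MvPolynomial.finSuccEquiv_X_succ,
      MvPolynomial.finSuccEquiv_X_succ, hq, Polynomial.C_mul]
  have hqm : q.Monic := Polynomial.monic_X_pow_sub_C _ two_ne_zero
  rw [hq1, ← Polynomial.modByMonic_eq_zero_iff_dvd hqm]
  set r := P %ₘ q with hr
  have hdeg : r.degree ≤ 1 := by
    have := Polynomial.degree_modByMonic_lt P hqm
    rw [hq, Polynomial.degree_X_pow_sub_C two_pos] at this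
    exact Order.le_of_lt_succ this
  have hrr := Polynomial.eq_X_add_C_of_degree_le_one hdeg
  -- on the conic, `G` agrees with its remainder
  have key : ∀ (x : Fin 2 → K) (y : K), x 0 ≠ 0 → y ^ 2 = x 0 * x 1 →
      MvPolynomial.eval x (r.coeff 1) * y + MvPolynomial.eval x (r.coeff 0) = 0 := by
    intro x y hx hy
    have h1 := MvPolynomial.eval_eq_eval_mv_eval' x y G
    have h2 : (Fin.cons y x : Fin 3 → K) = x 0 • ![y / x 0, 1, (y / x 0) ^ 2] := by
      ext i
      fin_cases i
      · exact (mul_div_cancel₀ _ hx).symm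
      · simp
      · change x 1 = x 0 * (y / x 0) ^ 2
        rw [div_pow, hy]
        field_simp
    rw [h2, eval_smul_of_isHomogeneous hd, h, mul_zero, ← hP,
      ← Polynomial.modByMonic_add_div P q, ← hr] at h1
    have h3 : Polynomial.eval y (q.map (MvPolynomial.eval x)) = 0 := by
      simp [hq, hy]
    rw [Polynomial.map_add, Polynomial.map_mul, Polynomial.eval_add, Polynomial.eval_mul, h3,
      zero_mul, add_zero, hrr] at h1
    simpa using h1.symm
  -- the points `(± y, x₀, x₁)` both lie on the conic
  have key2 : ∀ x : Fin 2 → K, x 0 ≠ 0 →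
      MvPolynomial.eval x (r.coeff 0) = 0 ∧ x 1 * MvPolynomial.eval x (r.coeff 1) = 0 := by
    intro x hx
    obtain ⟨y, hy⟩ := IsAlgClosed.exists_pow_nat_eq (x 0 * x 1) two_pos
    have h1 := key x y hx hy
    have h2 := key x (-y) hx (by rw [neg_sq, hy])
    have h3 : MvPolynomial.eval x (r.coeff 0) = 0 := by
      have : (2 : K) * MvPolynomial.eval x (r.coeff 0) = 0 := by linear_combination h1 + h2
      exact (mul_eq_zero.1 this).resolve_left two_ne_zero
    refine ⟨h3, ?_⟩
    rw [h3, add_zero] at h1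
    have : x 0 * (x 1 * MvPolynomial.eval x (r.coeff 1)) = 0 := by
      rw [← mul_assoc, ← hy, pow_two, mul_assoc, mul_comm y (MvPolynomial.eval x _), h1, mul_zero]
    exact (mul_eq_zero.1 this).resolve_left hx
  have hr0 : r.coeff 0 = 0 := by
    have : MvPolynomial.X 0 * r.coeff 0 = 0 := by
      refine MvPolynomial.funext fun x => ?_
      rw [map_mul, map_zero, MvPolynomial.eval_X]
      by_cases hx : x 0 = 0
      · rw [hx, zero_mul]
      · rw [(key2 x hx).1, mul_zero]
    exact (mul_eq_zero.1 this).resolve_left (MvPolynomial.X_ne_zero 0)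
  have hr1 : r.coeff 1 = 0 := by
    have : MvPolynomial.X 0 * (MvPolynomial.X 1 * r.coeff 1) = 0 := by
      refine MvPolynomial.funext fun x => ?_
      rw [map_mul, map_mul, map_zero, MvPolynomial.eval_X, MvPolynomial.eval_X]
      by_cases hx : x 0 = 0
      · rw [hx, zero_mul]
      · rw [(key2 x hx).2, mul_zero]
    exact (mul_eq_zero.1 ((mul_eq_zero.1 this).resolve_left
      (MvPolynomial.X_ne_zero 0))).resolve_left (MvPolynomial.X_ne_zero 1)
  rw [hrr, hr0, hr1]
  simp

/-! ### Divisors of forms, and curves with known intersection numbers -/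

/-- The cofactor of a form in a form is a form. -/
theorem isHomogeneous_of_mul_left {F G : MvPolynomial (Fin 3) K} {d e : ℕ} (hF : F ≠ 0)
    (hG : G ≠ 0) (hFd : F.IsHomogeneous e) (h : (F * G).IsHomogeneous d) :
    e ≤ d ∧ G.IsHomogeneous (d - e) := by
  classical
  let _ := MvPolynomial.gradedAlgebra (σ := Fin 3) (R := K)
  have h1 := DirectSum.coe_decompose_mul_of_left_mem
    (MvPolynomial.homogeneousSubmodule (Fin 3) K) (b := G) d hFd
  rw [DirectSum.decompose_of_mem_same _ h] at h1
  split_ifs at h1 with hle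
  · refine ⟨hle, ?_⟩
    rw [mul_left_cancel₀ hF h1]
    exact (DirectSum.decompose (MvPolynomial.homogeneousSubmodule (Fin 3) K) G (d - e)).2
  · exact absurd h1 (mul_ne_zero hF hG)

/-- The data of a curve `C = 0` of degree `e` used in the inequalities between degree and
multiplicities: its multiplicity at the points `p i` is at most one, and zero for `i` outside of
`U`, and it satisfies the Bézout inequality at the points `p i`, `i ∈ T`, for all forms that do not
contain it. For a curve that is nonsingular at the points `p i` one may take for `T` any set of
points on the curve, and for `U` any set that contains all of them. -/
structure IsTestCurve {ι : Type*} [DecidableEq ι] (p : ι → Fin 3 → K)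
    (C : MvPolynomial (Fin 3) K) (e : ℕ) (T U : Finset ι) : Prop where
  ne_zero : C ≠ 0
  isHomogeneous : C.IsHomogeneous e
  pos : 0 < e
  ord_le : ∀ i, ord (p i) C ≤ if i ∈ U then 1 else 0
  bezout : ∀ (F : MvPolynomial (Fin 3) K) (d : ℕ), F ≠ 0 → F.IsHomogeneous d → ¬ C ∣ F →
    ∑ i ∈ T, ord (p i) F ≤ e * d

/-- A form is a product of some of the curves `C k` and of a form containing none of them. If the
inequality `∑ w i * ord (p i) F ≤ c * deg F` holds for the curves themselves, and follows from the
Bézout inequalities for the remaining factor, then it holds for all nonzero forms. -/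
theorem sum_mul_ord_le {ι κ : Type*} [DecidableEq ι] [Fintype ι] {p : ι → Fin 3 → K}
    {C : κ → MvPolynomial (Fin 3) K} {e : κ → ℕ} {T U : κ → Finset ι}
    (hC : ∀ k, IsTestCurve p (C k) (e k) (T k) (U k)) (w : ι → ℕ) (c : ℕ)
    (hw : ∀ k, ∑ i ∈ U k, w i ≤ c * e k)
    (hpos : ∀ (o : ι → ℕ) (d : ℕ), (∀ k, ∑ i ∈ T k, o i ≤ e k * d) → (∀ i, o i ≤ d) →
      ∑ i, w i * o i ≤ c * d) {F : MvPolynomial (Fin 3) K} {d : ℕ} (hF : F ≠ 0)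
    (hd : F.IsHomogeneous d) : ∑ i, w i * ord (p i) F ≤ c * d := by
  induction d using Nat.strong_induction_on generalizing F with
  | _ d ih =>
    by_cases hk : ∃ k, C k ∣ F
    · obtain ⟨k, G, rfl⟩ := hk
      have hG : G ≠ 0 := right_ne_zero_of_mul hF
      obtain ⟨hle, hGd⟩ := isHomogeneous_of_mul_left (hC k).ne_zero hG (hC k).isHomogeneous hd
      have h1 := ih (d - e k) (by have := (hC k).pos; omega) hG hGd
      have h2 : ∑ i, w i * ord (p i) (C k) ≤ ∑ i ∈ U k, w i := by
        calc _ ≤ ∑ i, if i ∈ U k then w i else 0 := Finset.sum_le_sum fun i _ => by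
              have := (hC k).ord_le i
              split_ifs at this ⊢
              · exact (Nat.mul_le_mul_left _ this).trans_eq (mul_one _)
              · rw [Nat.le_zero.1 this, mul_zero]
          _ = _ := by rw [Finset.sum_ite_mem, Finset.univ_inter]
      simp only [ord_mul _ (hC k).ne_zero hG, mul_add, Finset.sum_add_distrib]
      calc _ ≤ c * e k + c * (d - e k) := add_le_add (h2.trans (hw k)) h1
        _ = c * d := by rw [← mul_add, Nat.add_sub_cancel' hle]
    · push Not at hk
      exact hpos _ d (fun k => (hC k).bezout F d hF hd (hk k))
        fun i => ord_le_of_isHomogeneous (p i) hd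

/-! ### Lines as test curves -/

/-- The linear form with coefficient vector `a`. -/
def lin (a : Fin 3 → K) : MvPolynomial (Fin 3) K := ∑ i, MvPolynomial.C (a i) * MvPolynomial.X i

theorem eval_lin (a x : Fin 3 → K) : MvPolynomial.eval x (lin a) = a ⬝ᵥ x := by
  simp [lin, dotProduct]

theorem isHomogeneous_lin (a : Fin 3 → K) : (lin a).IsHomogeneous 1 :=
  MvPolynomial.IsHomogeneous.sum _ _ _ fun _ _ => MvPolynomial.isHomogeneous_C_mul_X _ _

theorem lin_ne_zero {a : Fin 3 → K} (ha : a ≠ 0) : lin a ≠ 0 := by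
  intro h
  refine ha (funext fun i => ?_)
  simpa [eval_lin] using congrArg (MvPolynomial.eval (Pi.single i 1)) h

theorem onLine_iff {P ℓ : Plane K} : OnLine P ℓ ↔ P.rep ⬝ᵥ ℓ.rep = 0 := by
  conv_lhs => rw [OnLine, ← P.mk_rep, ← ℓ.mk_rep]
  exact Projectivization.orthogonal_mk P.rep_nonzero ℓ.rep_nonzero

theorem onLine_iff_eval {P ℓ : Plane K} :
    OnLine P ℓ ↔ MvPolynomial.eval P.rep (lin ℓ.rep) = 0 := by
  rw [onLine_iff, eval_lin, dotProduct_comm]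

theorem eq_of_cross_eq_zero {P Q : Plane K} (h : crossProduct P.rep Q.rep = 0) : P = Q := by
  rw [← P.mk_rep, ← Q.mk_rep, Projectivization.mk_eq_mk_iff_crossProduct_eq_zero]
  exact h

/-- Finitely many points are avoided by some line. -/
theorem exists_dotProduct_ne_zero [Infinite K] (T : Finset (Fin 3 → K)) (hT : ∀ x ∈ T, x ≠ 0) :
    ∃ b : Fin 3 → K, ∀ x ∈ T, b ⬝ᵥ x ≠ 0 := by
  have h : ∏ x ∈ T, lin x ≠ 0 := Finset.prod_ne_zero_iff.2 fun x hx => lin_ne_zero (hT x hx)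
  by_contra! hc
  refine h (MvPolynomial.funext fun b => ?_)
  obtain ⟨x, hx, hb⟩ := hc b
  rw [map_prod, map_zero, Finset.prod_eq_zero hx]
  rw [eval_lin, dotProduct_comm, hb]

/-- Bézout for a parametrised curve, in coordinates `y = B x`: a form whose multiplicities at points
of the curve sum up to more than the product of the degrees vanishes on the curve. -/
theorem eval_subst_inv_eq_zero {B : Matrix (Fin 3) (Fin 3) K} (hB : IsUnit B.det) {ι : Type*}
    {e : ℕ} {g : Fin 3 → Polynomial K} (hg : ∀ i, (g i).natDegree ≤ e) (p : ι → Fin 3 → K)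
    (S : Finset ι) {s c : ι → K} (hs : Set.InjOn s S) (hc : ∀ i ∈ S, c i ≠ 0)
    (h : ∀ i ∈ S, B *ᵥ p i = c i • fun j => (g j).eval (s i))
    {F : MvPolynomial (Fin 3) K} {d : ℕ} (hd : F.IsHomogeneous d)
    (hlt : e * d < ∑ i ∈ S, ord (p i) F) (t : K) :
    MvPolynomial.eval (fun j => (g j).eval t) (subst B⁻¹ F) = 0 := by
  have h0 : MvPolynomial.aeval g (subst B⁻¹ F) = 0 := by
    rw [aeval_subst]
    have hdeg : ∀ i, ((B⁻¹.map (algebraMap K (Polynomial K)) *ᵥ g) i).natDegree ≤ e := by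
      intro i
      simp only [mulVec, dotProduct, Matrix.map_apply, ← Polynomial.C_eq_algebraMap]
      exact Polynomial.natDegree_sum_le_of_forall_le _ _ fun j _ =>
        (Polynomial.natDegree_C_mul_le _ _).trans (hg j)
    have hval : ∀ i ∈ S, ∀ j, ((B⁻¹.map (algebraMap K (Polynomial K)) *ᵥ g) j).eval (s i)
        = (c i)⁻¹ * p i j := by
      intro i hi j
      have h1 : B⁻¹ *ᵥ (fun j => (g j).eval (s i)) = (c i)⁻¹ • p i := by
        rw [eq_inv_smul_iff₀ (hc i hi), ← mulVec_smul, ← h i hi, mulVec_mulVec,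
          nonsing_inv_mul _ hB, one_mulVec]
      have h2 := congrFun h1 j
      rw [Pi.smul_apply, smul_eq_mul] at h2
      rw [← h2]
      simp [mulVec, dotProduct, Polynomial.eval_finsetSum]
    exact aeval_eq_zero_of_lt_sum_ord hdeg p S hs (fun i hi => inv_ne_zero (hc i hi)) hval hd hlt
  have h1 := congrArg (Polynomial.aeval t) h0
  rw [map_zero, ← AlgHom.comp_apply, MvPolynomial.comp_aeval] at h1
  simpa [MvPolynomial.aeval_eq_eval] using h1

theorem isTestCurve_lin [Infinite K] {ι : Type*} [DecidableEq ι] {P : ι → Plane K}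
    (hP : Function.Injective P) (ℓ : Plane K) {T U : Finset ι}
    (hT : ∀ i ∈ T, OnLine (P i) ℓ) (hU : ∀ i, OnLine (P i) ℓ → i ∈ U) :
    IsTestCurve (fun i => (P i).rep) (lin ℓ.rep) 1 T U where
  ne_zero := lin_ne_zero ℓ.rep_nonzero
  isHomogeneous := isHomogeneous_lin _
  pos := one_pos
  ord_le i := by
    split_ifs with hi
    · exact ord_le_of_isHomogeneous _ (isHomogeneous_lin _)
    · exact (ord_eq_zero fun h => hi (hU i (onLine_iff_eval.2 h))).le
  bezout F d hF hd hdvd := by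
    classical
    by_contra! hlt
    refine hdvd ?_
    obtain ⟨i₀, hi₀⟩ : T.Nonempty := by
      by_contra h
      simp [Finset.not_nonempty_iff_eq_empty.1 h] at hlt
    set a := ℓ.rep with ha
    -- coordinates `a`, `b`, `f` of the plane such that no given point lies on the line `b = 0`
    obtain ⟨b, hb⟩ := exists_dotProduct_ne_zero (T.image fun i => (P i).rep) fun x hx => by
      obtain ⟨i, -, rfl⟩ := Finset.mem_image.1 hx
      exact (P i).rep_nonzero
    replace hb : ∀ i ∈ T, b ⬝ᵥ (P i).rep ≠ 0 := fun i hi => hb _ (Finset.mem_image_of_mem _ hi)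
    have haP : ∀ i ∈ T, a ⬝ᵥ (P i).rep = 0 := fun i hi => by
      rw [dotProduct_comm]; exact onLine_iff.1 (hT i hi)
    obtain ⟨f, hf⟩ : ∃ f : Fin 3 → K, f ⬝ᵥ crossProduct a b ≠ 0 := by
      obtain ⟨f, hf⟩ := exists_dotProduct_ne_zero {crossProduct a b} fun x hx => by
        rw [Finset.mem_singleton.1 hx]
        intro h0
        -- `b` would be a multiple of `a`, and vanish at the point with index `i₀`
        have h1 : crossProduct (crossProduct a b) (P i₀).rep = 0 := by rw [h0]; simp
        rw [cross_cross_eq_smul_sub_smul, haP i₀ hi₀, zero_smul, zero_sub, neg_eq_zero] at h1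
        exact (smul_ne_zero (hb i₀ hi₀) ℓ.rep_nonzero) h1
      exact ⟨f, hf _ (Finset.mem_singleton_self _)⟩
    set B : Matrix (Fin 3) (Fin 3) K := ![a, b, f] with hB
    have hdet : IsUnit B.det := by
      rw [isUnit_iff_ne_zero, det_fin_three]
      convert hf using 1
      simp [hB, cross_apply, dotProduct, Fin.sum_univ_three]
      ring
    have hBi : B * B⁻¹ = 1 := mul_nonsing_inv _ hdet
    have hiB : B⁻¹ * B = 1 := nonsing_inv_mul _ hdet
    have hBx : ∀ x, B *ᵥ x = ![a ⬝ᵥ x, b ⬝ᵥ x, f ⬝ᵥ x] := fun x => by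
      ext i; fin_cases i <;> rfl
    have hzero : ∀ s : K, MvPolynomial.eval ![0, 1, s] (subst B⁻¹ F) = 0 := by
      intro s
      have := eval_subst_inv_eq_zero hdet (e := 1) (g := ![0, 1, Polynomial.X])
        (fun i => by fin_cases i <;> simp) (fun i => (P i).rep) T
        (s := fun i => f ⬝ᵥ (P i).rep / b ⬝ᵥ (P i).rep) (c := fun i => b ⬝ᵥ (P i).rep)
        ?_ hb ?_ hd hlt s
      · have h0 : (fun j => ((![0, 1, Polynomial.X] : Fin 3 → Polynomial K) j).eval s)
            = ![0, 1, s] := by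
          ext j
          fin_cases j <;> simp
        rwa [h0] at this
      · intro i hi j hj hij
        -- points of the line are determined by the ratio of `b` and `f`
        have hbi := hb i hi
        have hbj := hb j hj
        rw [div_eq_div_iff hbi hbj] at hij
        refine hP (eq_of_cross_eq_zero ?_)
        have h1 : B *ᵥ ((b ⬝ᵥ (P j).rep) • (P i).rep) = B *ᵥ ((b ⬝ᵥ (P i).rep) • (P j).rep) := by
          rw [hBx, hBx]
          simp only [dotProduct_smul, smul_eq_mul, haP i hi, haP j hj, mul_zero]
          rw [mul_comm (b ⬝ᵥ (P j).rep) (b ⬝ᵥ (P i).rep), mul_comm _ (f ⬝ᵥ (P i).rep), hij,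
            mul_comm (f ⬝ᵥ (P j).rep)]
        have h2 := congrArg (B⁻¹ *ᵥ ·) h1
        simp only [mulVec_mulVec, hiB, one_mulVec] at h2
        have h3 := congrArg (fun v => crossProduct v (P j).rep) h2
        simp only [map_smul, LinearMap.smul_apply, cross_self, smul_zero] at h3
        exact (smul_eq_zero.1 h3).resolve_left hbj
      · intro i hi
        rw [hBx, haP i hi]
        have hbi := hb i hi
        ext j
        fin_cases j <;> simp [mul_div_cancel₀ _ hbi]
    have h1 := X_dvd_of_eval_eq_zero (isHomogeneous_subst _ hd) hzero
    have h2 := map_dvd (subst B) h1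
    rw [subst_subst_of_mul_eq_one hiB] at h2
    convert h2 using 1
    simp [subst, lin, mulVec, dotProduct]
    rfl

/-! ### The conic through five points -/

/-- Coordinates of `p 3` and `p 4` in the basis `p 0, p 1, p 2`, for five points no three of which
are collinear. -/
theorem exists_coordinates (p : Fin 5 → Fin 3 → K)
    (hp : ∀ i j k, i ≠ j → i ≠ k → j ≠ k → p i ⬝ᵥ crossProduct (p j) (p k) ≠ 0) :
    ∃ (M : Matrix (Fin 3) (Fin 3) K) (y z : Fin 3 → K), M.det ≠ 0 ∧
      (∀ v, M *ᵥ v = v 0 • p 0 + v 1 • p 1 + v 2 • p 2) ∧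
      p 3 = y 0 • p 0 + y 1 • p 1 + y 2 • p 2 ∧ p 4 = z 0 • p 0 + z 1 • p 1 + z 2 • p 2 ∧
      (∀ i, y i ≠ 0) ∧ (∀ i, z i ≠ 0) ∧ ∀ i j, i ≠ j → z i * y j - z j * y i ≠ 0 := by
  set M : Matrix (Fin 3) (Fin 3) K := (of ![p 0, p 1, p 2])ᵀ with hM
  have h012 := hp 0 1 2 (by decide) (by decide) (by decide)
  have hMdet : M.det ≠ 0 := by
    convert h012 using 1
    rw [hM, det_transpose, det_fin_three, cross_apply, vec3_dotProduct]
    simp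
    ring
  have hMv : ∀ v : Fin 3 → K, M *ᵥ v = v 0 • p 0 + v 1 • p 1 + v 2 • p 2 := by
    intro v
    ext i
    simp [hM, mulVec, dotProduct, Fin.sum_univ_three, mul_comm]
  have hcoord : ∀ x : Fin 3 → K, ∃ v : Fin 3 → K, x = v 0 • p 0 + v 1 • p 1 + v 2 • p 2 :=
    fun x => ⟨M⁻¹ *ᵥ x, by
      rw [← hMv, mulVec_mulVec, mul_nonsing_inv _ hMdet.isUnit, one_mulVec]⟩
  obtain ⟨y, hy⟩ := hcoord (p 3)
  obtain ⟨z, hz⟩ := hcoord (p 4)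
  have hy' : ∀ i, y i ≠ 0 := by
    have h0 := hp 3 1 2 (by decide) (by decide) (by decide)
    have h1 := hp 3 0 2 (by decide) (by decide) (by decide)
    have h2 := hp 3 0 1 (by decide) (by decide) (by decide)
    rw [hy, cross_apply, vec3_dotProduct] at h0 h1 h2
    simp only [Pi.add_apply, Pi.smul_apply, smul_eq_mul, cons_val] at h0 h1 h2
    have a0 : y 0 ≠ 0 := fun h => h0 (by rw [h]; ring)
    have a1 : y 1 ≠ 0 := fun h => h1 (by rw [h]; ring)
    have a2 : y 2 ≠ 0 := fun h => h2 (by rw [h]; ring)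
    intro i
    fin_cases i
    exacts [a0, a1, a2]
  have hz' : ∀ i, z i ≠ 0 := by
    have h0 := hp 4 1 2 (by decide) (by decide) (by decide)
    have h1 := hp 4 0 2 (by decide) (by decide) (by decide)
    have h2 := hp 4 0 1 (by decide) (by decide) (by decide)
    rw [hz, cross_apply, vec3_dotProduct] at h0 h1 h2
    simp only [Pi.add_apply, Pi.smul_apply, smul_eq_mul, cons_val] at h0 h1 h2
    have a0 : z 0 ≠ 0 := fun h => h0 (by rw [h]; ring)
    have a1 : z 1 ≠ 0 := fun h => h1 (by rw [h]; ring)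
    have a2 : z 2 ≠ 0 := fun h => h2 (by rw [h]; ring)
    intro i
    fin_cases i
    exacts [a0, a1, a2]
  have hyz : ∀ i j, i ≠ j → z i * y j - z j * y i ≠ 0 := by
    have h0 := hp 0 3 4 (by decide) (by decide) (by decide)
    have h1 := hp 1 3 4 (by decide) (by decide) (by decide)
    have h2 := hp 2 3 4 (by decide) (by decide) (by decide)
    rw [hy, hz, cross_apply, vec3_dotProduct] at h0 h1 h2
    rw [cross_apply, vec3_dotProduct] at h012
    simp only [Pi.add_apply, Pi.smul_apply, smul_eq_mul, cons_val] at h0 h1 h2 h012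
    have h0' : z 1 * y 2 - z 2 * y 1 ≠ 0 := by
      contrapose! h0
      linear_combination (-(p 0 0 * (p 1 1 * p 2 2 - p 1 2 * p 2 1) + p 0 1 * (p 1 2 * p 2 0 -
        p 1 0 * p 2 2) + p 0 2 * (p 1 0 * p 2 1 - p 1 1 * p 2 0))) * h0
    have h1' : z 0 * y 2 - z 2 * y 0 ≠ 0 := by
      contrapose! h1
      linear_combination ((p 0 0 * (p 1 1 * p 2 2 - p 1 2 * p 2 1) + p 0 1 * (p 1 2 * p 2 0 -
        p 1 0 * p 2 2) + p 0 2 * (p 1 0 * p 2 1 - p 1 1 * p 2 0))) * h1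
    have h2' : z 0 * y 1 - z 1 * y 0 ≠ 0 := by
      contrapose! h2
      linear_combination (-(p 0 0 * (p 1 1 * p 2 2 - p 1 2 * p 2 1) + p 0 1 * (p 1 2 * p 2 0 -
        p 1 0 * p 2 2) + p 0 2 * (p 1 0 * p 2 1 - p 1 1 * p 2 0))) * h2
    intro i j hij h
    rw [sub_eq_zero] at h
    rw [sub_ne_zero] at h0' h1' h2'
    fin_cases i <;> fin_cases j <;> first | exact hij rfl | skip
    · exact h2' h
    · exact h1' h
    · exact h2' h.symm
    · exact h0' h
    · exact h1' h.symm
    · exact h0' h.symm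
  exact ⟨M, y, z, hMdet, hMv, hy, hz, hy', hz', hyz⟩

/-- Five points, no three of them collinear, lie on a conic `s ↦ A (s, 1, s²)`. -/
theorem exists_conic_parametrization [Infinite K] (p : Fin 5 → Fin 3 → K)
    (hp : ∀ i j k, i ≠ j → i ≠ k → j ≠ k → p i ⬝ᵥ crossProduct (p j) (p k) ≠ 0) :
    ∃ (A : Matrix (Fin 3) (Fin 3) K) (s c : Fin 5 → K), IsUnit A.det ∧ Function.Injective s ∧
      (∀ i, c i ≠ 0) ∧ ∀ i, A *ᵥ ![s i, 1, s i ^ 2] = c i • p i := by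
  classical
  obtain ⟨M, y, z, hMdet, hMv, hy, hz, hy', hz', hyz⟩ := exists_coordinates p hp
  -- In the basis `p 0, p 1, p 2` the parametrisation has the coordinates
  -- `- σ i * y i * ∏ j ≠ i, (s - σ j)`, so that `p i` has parameter `σ i` and `p 3` has
  -- parameter `0`. The choice of `σ` makes `1` the parameter of `p 4`.
  obtain ⟨κ, hκ⟩ := Infinite.exists_notMem_finset
    ({0, z 0 / y 0, z 1 / y 1, z 2 / y 2} : Finset K)
  simp only [Finset.mem_insert, Finset.mem_singleton, not_or] at hκ
  obtain ⟨hκ0, hκ1, hκ2, hκ3⟩ := hκ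
  have hden : ∀ i, z i - κ * y i ≠ 0 := by
    intro i h
    have h1 : κ = z i / y i := by
      rw [eq_div_iff (hy' i)]
      linear_combination -h
    fin_cases i
    exacts [hκ1 h1, hκ2 h1, hκ3 h1]
  obtain ⟨σ, hσ⟩ : ∃ σ : Fin 3 → K, ∀ i, σ i * (z i - κ * y i) = z i :=
    ⟨fun i => z i / (z i - κ * y i), fun i => div_mul_cancel₀ _ (hden i)⟩
  have hσ0 : ∀ i, σ i ≠ 0 := fun i h => hz' i (by rw [← hσ i, h, zero_mul])
  have hσ1 : ∀ i, σ i ≠ 1 := fun i h => by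
    have := hσ i
    rw [h, one_mul, sub_eq_self] at this
    exact mul_ne_zero hκ0 (hy' i) this
  have hσi : ∀ i j, i ≠ j → σ i ≠ σ j := by
    intro i j hij h
    have h1 := hσ i
    rw [h] at h1
    refine mul_ne_zero hκ0 (mul_ne_zero (hσ0 j) (hyz i j hij)) ?_
    linear_combination (z j) * h1 - (z i) * (hσ j)
  set V : Matrix (Fin 3) (Fin 3) K := of ![
    (-σ 0 * y 0) • ![-(σ 1 + σ 2), σ 1 * σ 2, 1], (-σ 1 * y 1) • ![-(σ 0 + σ 2), σ 0 * σ 2, 1],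
    (-σ 2 * y 2) • ![-(σ 0 + σ 1), σ 0 * σ 1, 1]] with hV
  have hVv : ∀ s : K, V *ᵥ ![s, 1, s ^ 2] = ![-σ 0 * y 0 * ((s - σ 1) * (s - σ 2)),
      -σ 1 * y 1 * ((s - σ 0) * (s - σ 2)), -σ 2 * y 2 * ((s - σ 0) * (s - σ 1))] := by
    intro s
    ext i
    fin_cases i <;> simp [hV, mulVec, dotProduct, Fin.sum_univ_three] <;> ring
  have hVdet : V.det ≠ 0 := by
    have : V.det = (-σ 0 * y 0) * (-σ 1 * y 1) * (-σ 2 * y 2) *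
        ((σ 1 - σ 0) * (σ 0 - σ 2) * (σ 1 - σ 2)) := by
      rw [det_fin_three]
      simp [hV]
      ring
    rw [this]
    have h1 := sub_ne_zero.2 (hσi 1 0 (by decide))
    have h2 := sub_ne_zero.2 (hσi 0 2 (by decide))
    have h3 := sub_ne_zero.2 (hσi 1 2 (by decide))
    simp [hσ0, hy', h1, h2, h3]
  refine ⟨M * V, ![σ 0, σ 1, σ 2, 0, 1],
    ![-σ 0 * y 0 * ((σ 0 - σ 1) * (σ 0 - σ 2)), -σ 1 * y 1 * ((σ 1 - σ 0) * (σ 1 - σ 2)),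
      -σ 2 * y 2 * ((σ 2 - σ 0) * (σ 2 - σ 1)), -(σ 0 * σ 1 * σ 2),
      (1 - σ 0) * (1 - σ 1) * (1 - σ 2) / κ], ?_, ?_, ?_, ?_⟩
  · rw [det_mul]
    exact (mul_ne_zero hMdet hVdet).isUnit
  · have h01 := hσi 0 1 (by decide)
    have h02 := hσi 0 2 (by decide)
    have h12 := hσi 1 2 (by decide)
    simp only [Matrix.vecCons, Fin.cons_injective_iff, Set.mem_range, Fin.exists_fin_succ,
      Fin.cons_zero, Fin.cons_succ, not_or]
    simp [h01.symm, h02.symm, h12.symm, (hσ0 _).symm, (hσ1 _).symm,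
      Function.injective_of_subsingleton]
  · have h := fun i j hij => sub_ne_zero.2 (hσi i j hij)
    have h1 := fun i => sub_ne_zero.2 (hσ1 i).symm
    intro i
    fin_cases i <;> simp [hσ0, hy', h, h1, hκ0]
  · intro i
    rw [← mulVec_mulVec]
    fin_cases i
    · simp [hVv, hMv]
    · simp [hVv, hMv]
    · simp [hVv, hMv]
    · simp only [hVv, hMv]
      ext j
      have h0 := congrFun hy j
      simp at h0 ⊢
      rw [h0]
      ring
    · simp only [hVv, hMv]
      have h1 : ∀ i, -σ i * y i = (1 - σ i) * z i / κ := fun i => by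
        rw [eq_div_iff hκ0]
        linear_combination hσ i
      ext j
      have h0 := congrFun hz j
      simp only [h1]
      simp at h0 ⊢
      rw [h0]
      ring

/-- Through five points, no three of them collinear, there is a conic that is nonsingular at them
and satisfies the Bézout inequality. -/
theorem exists_isTestCurve_conic [IsAlgClosed K] [CharZero K] {ι : Type*} [DecidableEq ι]
    (p : ι → Fin 3 → K) {n : Fin 5 → ι} (hn : Function.Injective n)
    (hp : ∀ i j k, i ≠ j → i ≠ k → j ≠ k →
      p (n i) ⬝ᵥ crossProduct (p (n j)) (p (n k)) ≠ 0)
    (hV : ∀ F : MvPolynomial (Fin 3) K, F ≠ 0 → F.IsHomogeneous 2 →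
      (∀ i, MvPolynomial.eval (p (n i)) F = 0) → ∀ j ∉ Set.range n, MvPolynomial.eval (p j) F ≠ 0) :
    ∃ C : MvPolynomial (Fin 3) K,
      IsTestCurve p C 2 (Finset.univ.image n) (Finset.univ.image n) := by
  have : Infinite K := inferInstance
  obtain ⟨A, s, c, hA, hs, hc, h⟩ := exists_conic_parametrization (fun i => p (n i)) hp
  have hAi : A * A⁻¹ = 1 := mul_nonsing_inv _ hA
  have hiA : A⁻¹ * A = 1 := nonsing_inv_mul _ hA
  set q : MvPolynomial (Fin 3) K :=
    MvPolynomial.X 0 ^ 2 - MvPolynomial.X 1 * MvPolynomial.X 2 with hq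
  have hq2 : q.IsHomogeneous 2 := (MvPolynomial.isHomogeneous_X_pow 0 2).sub
    ((MvPolynomial.isHomogeneous_X K 1).mul (MvPolynomial.isHomogeneous_X K 2))
  have hC2 : (subst A⁻¹ q).IsHomogeneous 2 := isHomogeneous_subst _ hq2
  have hq0 : q ≠ 0 := fun h0 => by
    have := congrArg (MvPolynomial.eval ![1, 0, 0]) h0
    simp [hq] at this
  have hC0 : subst A⁻¹ q ≠ 0 := fun h0 => hq0 (by
    rw [← subst_subst_of_mul_eq_one (A := A) (B := A⁻¹) hiA q, h0, map_zero])
  have hinv : ∀ i, A⁻¹ *ᵥ p (n i) = (c i)⁻¹ • ![s i, 1, s i ^ 2] := fun i => by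
    rw [eq_inv_smul_iff₀ (hc i), ← mulVec_smul, ← h i, mulVec_mulVec, hiA, one_mulVec]
  have hCp : ∀ i, MvPolynomial.eval (p (n i)) (subst A⁻¹ q) = 0 := fun i => by
    rw [eval_subst, hinv, eval_smul_of_isHomogeneous hq2]
    simp [hq]
  refine ⟨subst A⁻¹ q, hC0, hC2, two_pos, fun j => ?_, fun F d hF hd hdvd => ?_⟩
  · split_ifs with hj
    · obtain ⟨i, -, rfl⟩ := Finset.mem_image.1 hj
      -- the line through `p i` in the direction `A (0, 0, 1)` is transversal to the conic
      have h1 := X_sub_C_pow_ord_dvd (s := 0) (p := p (n i)) (γ := fun j =>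
        Polynomial.C (p (n i) j) + Polynomial.X * Polynomial.C ((A *ᵥ ![0, 0, 1]) j))
        (by simp) (subst A⁻¹ q)
      rw [aeval_subst] at h1
      have h2 : ((A⁻¹).map (algebraMap K (Polynomial K)) *ᵥ fun j =>
          Polynomial.C (p (n i) j) + Polynomial.X * Polynomial.C ((A *ᵥ ![0, 0, 1]) j)) =
          fun j => Polynomial.C ((A⁻¹ *ᵥ p (n i)) j) +
            Polynomial.X * Polynomial.C ((![0, 0, 1] : Fin 3 → K) j) := by
        have h3 : ![0, 0, 1] = A⁻¹ *ᵥ (A *ᵥ ![0, 0, 1]) := by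
          rw [mulVec_mulVec, hiA, one_mulVec]
        conv_rhs => rw [h3]
        ext1 j
        simp only [mulVec, dotProduct, Matrix.map_apply, ← Polynomial.C_eq_algebraMap, map_sum,
          map_mul, Finset.mul_sum, ← Finset.sum_add_distrib]
        refine Finset.sum_congr rfl fun k _ => ?_
        rw [mul_add, Finset.mul_sum]
        congr 1
        refine Finset.sum_congr rfl fun l _ => ?_
        ring
      rw [h2, hinv] at h1
      have h4 : (MvPolynomial.aeval fun j => Polynomial.C (((c i)⁻¹ • ![s i, 1, s i ^ 2]) j) +
          Polynomial.X * Polynomial.C ((![0, 0, 1] : Fin 3 → K) j)) q =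
          Polynomial.C (-(c i)⁻¹) * Polynomial.X := by
        simp [hq]
        ring
      rw [h4, map_zero, sub_zero] at h1
      have h5 := Polynomial.natDegree_le_of_dvd h1 (mul_ne_zero
        (Polynomial.C_ne_zero.2 (neg_ne_zero.2 (inv_ne_zero (hc i)))) Polynomial.X_ne_zero)
      rw [Polynomial.natDegree_X_pow] at h5
      exact h5.trans ((Polynomial.natDegree_C_mul_le _ _).trans Polynomial.natDegree_X_le)
    · refine (ord_eq_zero (hV _ hC0 hC2 hCp j fun hr => hj ?_)).le
      obtain ⟨i, rfl⟩ := hr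
      exact Finset.mem_image_of_mem _ (Finset.mem_univ i)
  · by_contra! hlt
    refine hdvd ?_
    rw [Finset.sum_image hn.injOn] at hlt
    have hzero : ∀ t : K, MvPolynomial.eval ![t, 1, t ^ 2] (subst A F) = 0 := by
      intro t
      have h1 := eval_subst_inv_eq_zero (B := A⁻¹) (isUnit_nonsing_inv_det _ hA) (e := 2)
        (g := ![Polynomial.X, 1, Polynomial.X ^ 2]) (fun i => by fin_cases i <;> simp)
        (fun i => p (n i)) Finset.univ hs.injOn (fun i _ => inv_ne_zero (hc i))
        (fun i _ => by
          rw [hinv]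
          congr 1
          ext j
          fin_cases j <;> simp) hd hlt t
      have h0 : (fun j => ((![Polynomial.X, 1, Polynomial.X ^ 2] : Fin 3 → Polynomial K) j).eval t)
          = ![t, 1, t ^ 2] := by
        ext j
        fin_cases j <;> simp
      rwa [h0, nonsing_inv_nonsing_inv _ hA] at h1
    have h1 := map_dvd (subst A⁻¹) (conic_dvd_of_eval_eq_zero (isHomogeneous_subst _ hd) hzero)
    rwa [subst_subst_of_mul_eq_one hAi] at h1

/-! ### Lower bounds from configurations of test curves -/

/-- Every form of degree `d` with multiplicity at least `m` at all points of `Z` satisfies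
`a * m ≤ b * d`; that is, the Waldschmidt constant of `Z` is at least `a / b`. -/
def DegreeBound (a b : ℕ) (Z : Finset (Plane K)) : Prop :=
  ∀ m : ℕ, a * m ≤ b * initialDegree (symbolicPower Z m)

/-- The hypothesis `hw` is the inequality for the curves `C k` themselves, and `hpos` derives it
from the Bézout inequalities for a form that contains none of them. -/
theorem degreeBound_of_testCurves {ι κ : Type*} [DecidableEq ι] [Fintype ι]
    {Z : Finset (Plane K)} {P : ι → Plane K} (hPZ : ∀ i, P i ∈ Z)
    {C : κ → MvPolynomial (Fin 3) K} {e : κ → ℕ} {T U : κ → Finset ι}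
    (hC : ∀ k, IsTestCurve (fun i => (P i).rep) (C k) (e k) (T k) (U k)) (w : ι → ℕ) (c : ℕ)
    (hw : ∀ k, ∑ i ∈ U k, w i ≤ c * e k)
    (hpos : ∀ (o : ι → ℕ) (d : ℕ), (∀ k, ∑ i ∈ T k, o i ≤ e k * d) → (∀ i, o i ≤ d) →
      ∑ i, w i * o i ≤ c * d) :
    DegreeBound (∑ i, w i) c Z := by
  intro m
  obtain ⟨F, hF, hF0, hd⟩ := initialDegree_spec Z m
  rw [Finset.sum_mul]
  exact (Finset.sum_le_sum fun i _ => Nat.mul_le_mul_left _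
    (le_ord_of_mem_symbolicPower (hPZ i) hF0 hF)).trans (sum_mul_ord_le hC w c hw hpos hF0 hd)

theorem eq_or_eq_of_onLine {P Q ℓ ℓ' : Plane K} (h1 : OnLine P ℓ) (h2 : OnLine Q ℓ)
    (h3 : OnLine P ℓ') (h4 : OnLine Q ℓ') : P = Q ∨ ℓ = ℓ' :=
  Configuration.ofField.eq_or_eq_of_orthogonal h1 h2 h3 h4

theorem exists_line {P Q : Plane K} (h : P ≠ Q) : ∃ ℓ : Plane K, OnLine P ℓ ∧ OnLine Q ℓ := by
  classical
  exact ⟨_, Projectivization.orthogonal_cross_left h, Projectivization.orthogonal_cross_right h⟩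

/-- The test curves are the three lines of the quasi star and the three lines joining the points
`q i`. -/
theorem degreeBound_quasiStar [Infinite K] {Z : Finset (Plane K)}
    {v₁₂ v₁₃ v₂₃ q₁ q₂ q₃ L₁ L₂ L₃ M₁₂ M₁₃ M₂₃ : Plane K}
    (hZ : ∀ P ∈ [v₁₂, v₁₃, v₂₃, q₁, q₂, q₃], P ∈ Z)
    (hne : [v₁₂, v₁₃, v₂₃, q₁, q₂, q₃].Nodup)
    (h1 : OnLine v₁₂ L₁ ∧ OnLine v₁₃ L₁ ∧ OnLine q₁ L₁ ∧ ¬ OnLine v₂₃ L₁)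
    (h2 : OnLine v₁₂ L₂ ∧ OnLine v₂₃ L₂ ∧ OnLine q₂ L₂)
    (h3 : OnLine v₁₃ L₃ ∧ OnLine v₂₃ L₃ ∧ OnLine q₃ L₃)
    (h4 : OnLine q₁ M₁₂ ∧ OnLine q₂ M₁₂ ∧ ¬ OnLine q₃ M₁₂)
    (h5 : OnLine q₁ M₁₃ ∧ OnLine q₃ M₁₃)
    (h6 : OnLine q₂ M₂₃ ∧ OnLine q₃ M₂₃) : DegreeBound 9 4 Z := by
  have hP : Function.Injective ![v₁₂, v₁₃, v₂₃, q₁, q₂, q₃] :=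
    List.nodup_ofFn.1 (by simpa using hne)
  have key : DegreeBound (∑ i, ![1, 1, 1, 2, 2, 2] i) 4 Z := by
    refine degreeBound_of_testCurves (κ := Fin 6) (P := ![v₁₂, v₁₃, v₂₃, q₁, q₂, q₃])
      (C := fun k => lin (![L₁, L₂, L₃, M₁₂, M₁₃, M₂₃] k).rep) (e := fun _ => 1)
      (T := ![{0, 1, 3}, {0, 2, 4}, {1, 2, 5}, {3, 4}, {3, 5}, {4, 5}])
      (U := ![{0, 1, 3}, {0, 2, 4}, {1, 2, 5}, {3, 4}, {3, 5}, {4, 5}]) ?_ ?_ _ _ ?_ ?_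
    · intro i
      fin_cases i <;> exact hZ _ (by simp)
    · intro k
      refine isTestCurve_lin hP _ ?_ fun i => ?_
      · fin_cases k <;> simp [h1, h2, h3, h4, h5, h6]
      · simp only [List.nodup_cons, List.mem_cons, not_or] at hne
        fin_cases k <;> fin_cases i <;> simp <;> grind [eq_or_eq_of_onLine]
    · intro k
      fin_cases k <;> simp
    · intro o d h h'
      have := h 0
      have := h 1
      have := h 2
      have := h 3
      have := h 4
      have := h 5
      simp [Fin.sum_univ_succ] at *
      omega
  intro m
  have := key m
  simp [Fin.sum_univ_succ] at this
  omega

/-- The bound `9 / 4` of a quasi star improves when there is a further point `x` that lies on none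
of the test curves other than `L₁` and the line `M₂₃`, which has no point `q i` in common with
`L₁`. -/
theorem degreeBound_quasiStar_extra [Infinite K] {Z : Finset (Plane K)}
    {v₁₂ v₁₃ v₂₃ q₁ q₂ q₃ x L₁ L₂ L₃ M₁₂ M₁₃ M₂₃ : Plane K}
    (hZ : ∀ P ∈ [v₁₂, v₁₃, v₂₃, q₁, q₂, q₃, x], P ∈ Z)
    (hne : [v₁₂, v₁₃, v₂₃, q₁, q₂, q₃, x].Nodup)
    (h1 : OnLine v₁₂ L₁ ∧ OnLine v₁₃ L₁ ∧ OnLine q₁ L₁ ∧ ¬ OnLine v₂₃ L₁)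
    (h2 : OnLine v₁₂ L₂ ∧ OnLine v₂₃ L₂ ∧ OnLine q₂ L₂ ∧ ¬ OnLine x L₂)
    (h3 : OnLine v₁₃ L₃ ∧ OnLine v₂₃ L₃ ∧ OnLine q₃ L₃ ∧ ¬ OnLine x L₃)
    (h4 : OnLine q₁ M₁₂ ∧ OnLine q₂ M₁₂ ∧ ¬ OnLine q₃ M₁₂ ∧ ¬ OnLine x M₁₂)
    (h5 : OnLine q₁ M₁₃ ∧ OnLine q₃ M₁₃ ∧ ¬ OnLine x M₁₃)
    (h6 : OnLine q₂ M₂₃ ∧ OnLine q₃ M₂₃) : DegreeBound 145 64 Z := by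
  have hP : Function.Injective ![v₁₂, v₁₃, v₂₃, q₁, q₂, q₃, x] :=
    List.nodup_ofFn.1 (by simpa using hne)
  -- The weights make each of the six lines, with `x` counted on `L₁` and on `M₂₃`, have weight
  -- exactly `64`. As `x` need not lie on these two lines, it does not enter the Bézout
  -- inequalities.
  have key : DegreeBound (∑ i, ![13, 13, 21, 34, 30, 30, 4] i) 64 Z := by
    refine degreeBound_of_testCurves (κ := Fin 6) (P := ![v₁₂, v₁₃, v₂₃, q₁, q₂, q₃, x])
      (C := fun k => lin (![L₁, L₂, L₃, M₁₂, M₁₃, M₂₃] k).rep) (e := fun _ => 1)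
      (T := ![{0, 1, 3}, {0, 2, 4}, {1, 2, 5}, {3, 4}, {3, 5}, {4, 5}])
      (U := ![{0, 1, 3, 6}, {0, 2, 4}, {1, 2, 5}, {3, 4}, {3, 5}, {4, 5, 6}]) ?_ ?_ _ _ ?_ ?_
    · intro i
      fin_cases i <;> exact hZ _ (by simp)
    · intro k
      refine isTestCurve_lin hP _ ?_ fun i => ?_
      · fin_cases k <;> simp [h1, h2, h3, h4, h5, h6]
      · simp only [List.nodup_cons, List.mem_cons, not_or] at hne
        fin_cases k <;> fin_cases i <;> simp <;> grind [eq_or_eq_of_onLine]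
    · intro k
      fin_cases k <;> simp
    · intro o d h h'
      have := h 0
      have := h 1
      have := h 2
      have := h 3
      have := h 4
      have := h 5
      -- the bound `ord ≤ d` at `x`
      have := h' 6
      simp [Fin.sum_univ_succ] at *
      omega
  simpa [Fin.sum_univ_succ] using key

theorem degreeBound_star [Infinite K] {Z : Finset (Plane K)}
    {a b c d e f L₀ L₁ L₂ L₃ : Plane K}
    (hZ : ∀ P ∈ [a, b, c, d, e, f], P ∈ Z) (hne : [a, b, c, d, e, f].Nodup)
    (h0 : OnLine a L₀ ∧ OnLine b L₀ ∧ OnLine c L₀ ∧ ¬ OnLine d L₀)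
    (h1 : OnLine a L₁ ∧ OnLine d L₁ ∧ OnLine e L₁)
    (h2 : OnLine b L₂ ∧ OnLine d L₂ ∧ OnLine f L₂)
    (h3 : OnLine c L₃ ∧ OnLine e L₃ ∧ OnLine f L₃) : DegreeBound 2 1 Z := by
  have hP : Function.Injective ![a, b, c, d, e, f] :=
    List.nodup_ofFn.1 (by simpa using hne)
  have key : DegreeBound (∑ i : Fin 6, (fun _ => 1) i) 3 Z := by
    refine degreeBound_of_testCurves (κ := Fin 4) (P := ![a, b, c, d, e, f])
      (C := fun k => lin (![L₀, L₁, L₂, L₃] k).rep) (e := fun _ => 1)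
      (T := ![{0, 1, 2}, {0, 3, 4}, {1, 3, 5}, {2, 4, 5}])
      (U := ![{0, 1, 2}, {0, 3, 4}, {1, 3, 5}, {2, 4, 5}]) ?_ ?_ _ _ ?_ ?_
    · intro i
      fin_cases i <;> exact hZ _ (by simp)
    · intro k
      refine isTestCurve_lin hP _ ?_ fun i => ?_
      · fin_cases k <;> simp [h0, h1, h2, h3]
      · simp only [List.nodup_cons, List.mem_cons, not_or] at hne
        fin_cases k <;> fin_cases i <;> simp <;> grind [eq_or_eq_of_onLine]
    · intro k
      fin_cases k <;> simp
    · intro o d h h'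
      have := h 0
      have := h 1
      have := h 2
      have := h 3
      simp [Fin.sum_univ_succ] at *
      omega
  intro m
  have := key m
  simp at this
  omega

theorem degreeBound_star_extra [Infinite K] {Z : Finset (Plane K)}
    {a b c d e f x L₀ L₁ L₂ L₃ : Plane K}
    (hZ : ∀ P ∈ [a, b, c, d, e, f, x], P ∈ Z) (hne : [a, b, c, d, e, f, x].Nodup)
    (h0 : OnLine a L₀ ∧ OnLine b L₀ ∧ OnLine c L₀ ∧ ¬ OnLine d L₀ ∧ ¬ OnLine x L₀)
    (h1 : OnLine a L₁ ∧ OnLine d L₁ ∧ OnLine e L₁ ∧ ¬ OnLine x L₁)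
    (h2 : OnLine b L₂ ∧ OnLine d L₂ ∧ OnLine f L₂ ∧ ¬ OnLine x L₂)
    (h3 : OnLine c L₃ ∧ OnLine e L₃ ∧ OnLine f L₃ ∧ ¬ OnLine x L₃) : DegreeBound 7 3 Z := by
  have hP : Function.Injective ![a, b, c, d, e, f, x] :=
    List.nodup_ofFn.1 (by simpa using hne)
  have key : DegreeBound (∑ i : Fin 7, (fun _ => 1) i) 3 Z := by
    refine degreeBound_of_testCurves (κ := Fin 4) (P := ![a, b, c, d, e, f, x])
      (C := fun k => lin (![L₀, L₁, L₂, L₃] k).rep) (e := fun _ => 1)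
      (T := ![{0, 1, 2}, {0, 3, 4}, {1, 3, 5}, {2, 4, 5}])
      (U := ![{0, 1, 2}, {0, 3, 4}, {1, 3, 5}, {2, 4, 5}]) ?_ ?_ _ _ ?_ ?_
    · intro i
      fin_cases i <;> exact hZ _ (by simp)
    · intro k
      refine isTestCurve_lin hP _ ?_ fun i => ?_
      · fin_cases k <;> simp [h0, h1, h2, h3]
      · simp only [List.nodup_cons, List.mem_cons, not_or] at hne
        fin_cases k <;> fin_cases i <;> simp <;> grind [eq_or_eq_of_onLine]
    · intro k
      fin_cases k <;> simp
    · intro o d h h'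
      have := h 0
      have := h 1
      have := h 2
      have := h 3
      have := h' 6
      simp [Fin.sum_univ_succ] at *
      omega
  simpa using key

theorem exists_onLine_of_triple_eq_zero {P Q R : Plane K} (hQR : Q ≠ R)
    (h : P.rep ⬝ᵥ crossProduct Q.rep R.rep = 0) :
    ∃ ℓ : Plane K, OnLine P ℓ ∧ OnLine Q ℓ ∧ OnLine R ℓ := by
  have h0 : crossProduct Q.rep R.rep ≠ 0 := fun h0 => hQR (eq_of_cross_eq_zero h0)
  have key : ∀ S : Plane K, S.rep ⬝ᵥ crossProduct Q.rep R.rep = 0 → OnLine S (.mk K _ h0) := by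
    intro S hS
    have h1 := (Projectivization.orthogonal_mk S.rep_nonzero h0).2 hS
    rwa [S.mk_rep] at h1
  exact ⟨_, key P h, key Q (dot_self_cross _ _), key R (dot_cross_self _ _)⟩

/-- If five of six points not on a conic are in general position, and the line through the sixth
point and one of the five contains no other point, then this line and the conic through the five
points add up to a nef divisor. -/
theorem degreeBound_conic [IsAlgClosed K] [CharZero K] {Z : Finset (Plane K)}
    {p a b c d v M : Plane K} (hZ : ∀ P ∈ [p, a, b, c, d, v], P ∈ Z)
    (hne : [p, a, b, c, d, v].Nodup)
    (hconic : ∀ F : MvPolynomial (Fin 3) K, F.IsHomogeneous 2 →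
      (∀ P ∈ [p, a, b, c, d, v], MvPolynomial.eval P.rep F = 0) → F = 0)
    (h1 : OnLine p M) (h2 : OnLine v M)
    (h3 : ¬ OnLine a M ∧ ¬ OnLine b M ∧ ¬ OnLine c M ∧ ¬ OnLine d M)
    (hcol : ∀ ℓ, ¬ (OnLine p ℓ ∧ OnLine a ℓ ∧ OnLine b ℓ) ∧
      ¬ (OnLine p ℓ ∧ OnLine a ℓ ∧ OnLine c ℓ) ∧ ¬ (OnLine p ℓ ∧ OnLine a ℓ ∧ OnLine d ℓ) ∧
      ¬ (OnLine p ℓ ∧ OnLine b ℓ ∧ OnLine c ℓ) ∧ ¬ (OnLine p ℓ ∧ OnLine b ℓ ∧ OnLine d ℓ) ∧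
      ¬ (OnLine p ℓ ∧ OnLine c ℓ ∧ OnLine d ℓ) ∧ ¬ (OnLine a ℓ ∧ OnLine b ℓ ∧ OnLine c ℓ) ∧
      ¬ (OnLine a ℓ ∧ OnLine b ℓ ∧ OnLine d ℓ) ∧ ¬ (OnLine a ℓ ∧ OnLine c ℓ ∧ OnLine d ℓ) ∧
      ¬ (OnLine b ℓ ∧ OnLine c ℓ ∧ OnLine d ℓ)) : DegreeBound 7 3 Z := by
  have : Infinite K := inferInstance
  have hP : Function.Injective ![p, a, b, c, d, v] := List.nodup_ofFn.1 (by simpa using hne)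
  obtain ⟨C, hC⟩ := exists_isTestCurve_conic (fun i => (![p, a, b, c, d, v] i).rep)
    (Fin.castSucc_injective 5) (fun i j k hij hik hjk h0 => by
      obtain ⟨ℓ, hℓ⟩ := exists_onLine_of_triple_eq_zero
        (hP.ne ((Fin.castSucc_injective 5).ne hjk)) h0
      have hℓ' := hcol ℓ
      clear h0 hcol
      fin_cases i <;> fin_cases j <;> fin_cases k <;> simp at hij hik hjk hℓ <;> grind)
    (fun F hF hd h j hj h0 => hF (hconic F hd fun P hPl => by
      have hj5 : j = 5 := by
        by_contra h5
        exact hj ⟨j.castPred h5, Fin.castSucc_castPred _ _⟩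
      subst hj5
      simp only [List.mem_cons, List.not_mem_nil, or_false] at hPl
      rcases hPl with rfl | rfl | rfl | rfl | rfl | rfl
      exacts [h 0, h 1, h 2, h 3, h 4, h0]))
  rw [show Finset.univ.image (Fin.castSucc : Fin 5 → Fin 6) = {0, 1, 2, 3, 4} by decide] at hC
  have key : DegreeBound (∑ i, ![2, 1, 1, 1, 1, 1] i) 3 Z := by
    refine degreeBound_of_testCurves (κ := Fin 2) (P := ![p, a, b, c, d, v])
      (C := ![C, lin M.rep]) (e := ![2, 1])
      (T := ![{0, 1, 2, 3, 4}, {0, 5}])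
      (U := ![{0, 1, 2, 3, 4}, {0, 5}]) ?_ ?_ _ _ ?_ ?_
    · intro i
      fin_cases i <;> exact hZ _ (by simp)
    · intro k
      fin_cases k
      · exact hC
      · refine isTestCurve_lin hP _ ?_ fun i => ?_
        · simp [h1, h2]
        · fin_cases i <;> simp [h3]
    · intro k
      fin_cases k
      · simp
      · simp
    · intro o d h h'
      have := h 0
      have := h 1
      simp [Fin.sum_univ_succ] at *
      omega
  simpa [Fin.sum_univ_succ] using key

/-! ### Six points imposing independent conditions on conics -/

/-- The second Veronese map. -/
def veronese (x : Fin 3 → K) : Fin 6 → K :=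
  ![x 0 * x 0, x 1 * x 1, x 2 * x 2, x 0 * x 1, x 0 * x 2, x 1 * x 2]

theorem exists_eval_eq_veronese {F : MvPolynomial (Fin 3) K} (hF : F.IsHomogeneous 2) :
    ∃ φ : (Fin 6 → K) →ₗ[K] K, ∀ x, MvPolynomial.eval x F = φ (veronese x) := by
  rw [← MvPolynomial.mem_homogeneousSubmodule, ← MvPolynomial.homogeneousSubmodule_one_pow,
    MvPolynomial.homogeneousSubmodule_one_eq_span_X, pow_two, Submodule.span_mul_span] at hF
  induction hF using Submodule.span_induction with
  | mem F h =>
    obtain ⟨_, ⟨i, rfl⟩, _, ⟨j, rfl⟩, rfl⟩ := h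
    have : ∃ k : Fin 6, ∀ x : Fin 3 → K, x i * x j = veronese x k := by
      fin_cases i <;> fin_cases j
      exacts [⟨0, fun x => rfl⟩, ⟨3, fun x => rfl⟩, ⟨4, fun x => rfl⟩, ⟨3, fun x => mul_comm _ _⟩,
        ⟨1, fun x => rfl⟩, ⟨5, fun x => rfl⟩, ⟨4, fun x => mul_comm _ _⟩,
        ⟨5, fun x => mul_comm _ _⟩, ⟨2, fun x => rfl⟩]
    obtain ⟨k, hk⟩ := this
    exact ⟨LinearMap.proj k, fun x => by simp [hk]⟩
  | zero => exact ⟨0, fun x => by simp⟩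
  | add F G _ _ hF hG =>
    obtain ⟨φ, hφ⟩ := hF
    obtain ⟨ψ, hψ⟩ := hG
    exact ⟨φ + ψ, fun x => by simp [hφ, hψ]⟩
  | smul a F _ hF =>
    obtain ⟨φ, hφ⟩ := hF
    exact ⟨a • φ, fun x => by simp [hφ]⟩

theorem exists_quadratic_form {φ : (Fin 6 → K) →ₗ[K] K} (hφ : φ ≠ 0) :
    ∃ F : MvPolynomial (Fin 3) K, F ≠ 0 ∧ F.IsHomogeneous 2 ∧
      ∀ x, MvPolynomial.eval x F = φ (veronese x) := by
  let q : Fin 6 → MvPolynomial (Fin 3) K := fun k => ![.X 0, .X 1, .X 2, .X 0, .X 0, .X 1] k *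
    ![.X 0, .X 1, .X 2, .X 1, .X 2, .X 2] k
  have hq : ∀ x k, MvPolynomial.eval x (q k) = veronese x k := by
    intro x k
    fin_cases k <;> simp [q, veronese]
  have hφv : ∀ v : Fin 6 → K, φ v = ∑ k, φ (Pi.single k 1) * v k := by
    intro v
    rw [LinearMap.pi_apply_eq_sum_univ φ v]
    refine Finset.sum_congr rfl fun k _ => ?_
    rw [smul_eq_mul, mul_comm]
    congr 2
    ext j
    simp [Pi.single_apply, eq_comm]
  have hev : ∀ x, MvPolynomial.eval x (∑ k, MvPolynomial.C (φ (Pi.single k 1)) * q k)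
      = φ (veronese x) := by
    intro x
    rw [hφv (veronese x), map_sum]
    exact Finset.sum_congr rfl fun k _ => by rw [map_mul, MvPolynomial.eval_C, hq]
  refine ⟨_, fun h0 => hφ ?_, MvPolynomial.IsHomogeneous.sum _ _ _ fun k _ => ?_, hev⟩
  · have hx : ∀ x, φ (veronese x) = 0 := fun x => by rw [← hev, h0, map_zero]
    have h1 := hx ![1, 0, 0]
    have h2 := hx ![0, 1, 0]
    have h3 := hx ![0, 0, 1]
    have h4 := hx ![1, 1, 0]
    have h5 := hx ![1, 0, 1]
    have h6 := hx ![0, 1, 1]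
    rw [hφv, Fin.sum_univ_six] at h1 h2 h3 h4 h5 h6
    simp [veronese] at h1 h2 h3
    simp [veronese, h1, h2, h3] at h4 h5 h6
    refine LinearMap.ext fun v => ?_
    rw [hφv, Fin.sum_univ_six, h1, h2, h3, h4, h5, h6]
    simp
  · have : (q k).IsHomogeneous (1 + 1) := by
      refine MvPolynomial.IsHomogeneous.mul ?_ ?_ <;> fin_cases k <;>
        exact MvPolynomial.isHomogeneous_X _ _
    exact this.C_mul _

/-- The points of the list `l` are distinct points of `Z`, and lie on no conic. -/
structure OffConic (Z : Finset (Plane K)) (l : List (Plane K)) : Prop where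
  mem : ∀ P ∈ l, P ∈ Z
  nodup : l.Nodup
  eq_zero : ∀ F : MvPolynomial (Fin 3) K, F.IsHomogeneous 2 →
    (∀ P ∈ l, MvPolynomial.eval P.rep F = 0) → F = 0

theorem exists_offConic {Z : Finset (Plane K)} [Infinite K] (hZ : ¬ InConic Z) :
    ∃ a b c d e f : Plane K, OffConic Z [a, b, c, d, e, f] := by
  have hspan : Submodule.span K (Set.range fun P : Z => veronese P.1.rep) = ⊤ := by
    by_contra h
    obtain ⟨φ, hφ, hle⟩ := Submodule.exists_le_ker_of_lt_top _ (lt_top_iff_ne_top.2 h)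
    obtain ⟨F, hF, hd, hev⟩ := exists_quadratic_form hφ
    refine hZ ⟨F, hF, hd, fun P hP => ?_⟩
    rw [hev]
    exact hle (Submodule.subset_span ⟨⟨P, hP⟩, rfl⟩)
  obtain ⟨κ, n, hn, hspan', hli⟩ := exists_linearIndependent' K fun P : Z => veronese P.1.rep
  rw [hspan] at hspan'
  have : Finite κ := Finite.of_injective n hn
  have := Fintype.ofFinite κ
  have hcard : Fintype.card κ = 6 := by
    have := finrank_span_eq_card hli
    rw [hspan', finrank_top, Module.finrank_fin_fun] at this
    exact this.symm
  let ε : Fin 6 ≃ κ := (Fintype.equivFinOfCardEq hcard).symm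
  have hinj : Function.Injective fun k => (n (ε k)).1 :=
    Subtype.val_injective.comp (hn.comp ε.injective)
  suffices h : OffConic Z (List.ofFn fun k => (n (ε k)).1) by
    simp only [List.ofFn_succ, List.ofFn_zero] at h
    exact ⟨_, _, _, _, _, _, h⟩
  refine ⟨fun P hP => ?_, List.nodup_ofFn.2 hinj, fun F hd hF => ?_⟩
  · obtain ⟨k, rfl⟩ := (List.mem_ofFn' _ _).1 hP
    exact (n (ε k)).2
  · obtain ⟨φ, hφ⟩ := exists_eval_eq_veronese hd
    have hφ0 : φ = 0 := by
      refine LinearMap.ext_on_range hspan' fun k => ?_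
      have := hF _ ((List.mem_ofFn' _ _).2 ⟨ε.symm k, rfl⟩)
      rw [hφ] at this
      simpa using this
    refine MvPolynomial.funext fun x => ?_
    rw [hφ, hφ0]
    simp

/-- The indices `n` are kept as a list, so that `decide` proves that they form a permutation. -/
theorem OffConic.reorder {Z : Finset (Plane K)} {a b c d e f : Plane K}
    (h : OffConic Z [a, b, c, d, e, f]) (n : List (Fin 6)) (hn : n.Perm (List.finRange 6)) :
    OffConic Z (n.map ![a, b, c, d, e, f]) := by
  have hl : (n.map ![a, b, c, d, e, f]).Perm [a, b, c, d, e, f] := hn.map _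
  exact ⟨fun P hP => h.mem P (hl.mem_iff.1 hP), hl.nodup_iff.2 h.nodup,
    fun F hd hF => h.eq_zero F hd fun P hP => hF P (hl.mem_iff.2 hP)⟩

theorem OffConic.not_two_lines {Z : Finset (Plane K)} {l : List (Plane K)} (h : OffConic Z l)
    (ℓ ℓ' : Plane K) : ¬ ∀ P ∈ l, OnLine P ℓ ∨ OnLine P ℓ' := by
  intro hl
  refine mul_ne_zero (lin_ne_zero ℓ.rep_nonzero) (lin_ne_zero ℓ'.rep_nonzero)
    (h.eq_zero _ ((isHomogeneous_lin _).mul (isHomogeneous_lin _)) fun P hP => ?_)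
  rw [map_mul, mul_eq_zero, ← onLine_iff_eval, ← onLine_iff_eval]
  exact hl P hP

/-- If three of six points off a conic lie on a line, then the other three lie off this line, and
are not collinear. -/
theorem OffConic.not_onLine {Z : Finset (Plane K)} {a b c d e f ℓ : Plane K}
    (h : OffConic Z [a, b, c, d, e, f]) (ha : OnLine a ℓ) (hb : OnLine b ℓ) (hc : OnLine c ℓ) :
    ¬ OnLine d ℓ ∧ ¬ OnLine e ℓ ∧ ¬ OnLine f ℓ ∧
      ∀ ℓ', ¬ (OnLine d ℓ' ∧ OnLine e ℓ' ∧ OnLine f ℓ') := by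
  have hne := h.nodup
  simp only [List.nodup_cons, List.mem_cons, not_or] at hne
  have key : ∀ ℓ', ¬ ((OnLine d ℓ ∨ OnLine d ℓ') ∧ (OnLine e ℓ ∨ OnLine e ℓ') ∧
      (OnLine f ℓ ∨ OnLine f ℓ')) := fun ℓ' hh =>
    h.not_two_lines ℓ ℓ' (by simpa [ha, hb, hc] using hh)
  obtain ⟨ℓ₁, h1⟩ := exists_line (P := d) (Q := e) (by grind)
  obtain ⟨ℓ₂, h2⟩ := exists_line (P := d) (Q := f) (by grind)
  obtain ⟨ℓ₃, h3⟩ := exists_line (P := e) (Q := f) (by grind)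
  exact ⟨fun hd => key ℓ₃ ⟨.inl hd, .inr h3.1, .inr h3.2⟩,
    fun he => key ℓ₂ ⟨.inr h2.1, .inl he, .inr h2.2⟩,
    fun hf => key ℓ₁ ⟨.inr h1.1, .inr h1.2, .inl hf⟩,
    fun ℓ' h' => key ℓ' ⟨.inr h'.1, .inr h'.2.1, .inr h'.2.2⟩⟩

/-! ### Six points off a conic -/

/-- Three lines `L₁`, `L₂`, `L₃` forming a triangle with vertices `v₁₂`, `v₁₃`, `v₂₃` in `Z`, and
noncollinear further points `q₁`, `q₂`, `q₃` of `Z` on these lines. -/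
structure IsQuasiStarIn (Z : Finset (Plane K)) (v₁₂ v₁₃ v₂₃ q₁ q₂ q₃ L₁ L₂ L₃ : Plane K) :
    Prop where
  mem : ∀ P ∈ [v₁₂, v₁₃, v₂₃, q₁, q₂, q₃], P ∈ Z
  nodup : [v₁₂, v₁₃, v₂₃, q₁, q₂, q₃].Nodup
  line₁ : OnLine v₁₂ L₁ ∧ OnLine v₁₃ L₁ ∧ OnLine q₁ L₁ ∧ ¬ OnLine v₂₃ L₁
  line₂ : OnLine v₁₂ L₂ ∧ OnLine v₂₃ L₂ ∧ OnLine q₂ L₂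
  line₃ : OnLine v₁₃ L₃ ∧ OnLine v₂₃ L₃ ∧ OnLine q₃ L₃
  not_collinear : ∀ ℓ, ¬ (OnLine q₁ ℓ ∧ OnLine q₂ ℓ ∧ OnLine q₃ ℓ)

/-- Four lines `L i` whose six intersection points `a`, …, `f` are distinct and belong to `Z`. -/
structure IsStarIn (Z : Finset (Plane K)) (a b c d e f L₀ L₁ L₂ L₃ : Plane K) : Prop where
  mem : ∀ P ∈ [a, b, c, d, e, f], P ∈ Z
  nodup : [a, b, c, d, e, f].Nodup
  line₀ : OnLine a L₀ ∧ OnLine b L₀ ∧ OnLine c L₀ ∧ ¬ OnLine d L₀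
  line₁ : OnLine a L₁ ∧ OnLine d L₁ ∧ OnLine e L₁
  line₂ : OnLine b L₂ ∧ OnLine d L₂ ∧ OnLine f L₂
  line₃ : OnLine c L₃ ∧ OnLine e L₃ ∧ OnLine f L₃

/-- The possible outcomes of the classification of six points off a conic. -/
def SixPointOutcome (Z : Finset (Plane K)) : Prop :=
  DegreeBound 7 3 Z ∨
    (∃ v₁₂ v₁₃ v₂₃ q₁ q₂ q₃ L₁ L₂ L₃, IsQuasiStarIn Z v₁₂ v₁₃ v₂₃ q₁ q₂ q₃ L₁ L₂ L₃) ∨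
    ∃ a b c d e f L₀ L₁ L₂ L₃, IsStarIn Z a b c d e f L₀ L₁ L₂ L₃

section Classification

variable {Z : Finset (Plane K)} {a b c d e f L₁ L₂ L₃ : Plane K}

/-- Three lines, each with three of the points, form a triangle: two of them with none of the points
in common would form a conic, and three through one point would contain seven points. The points
are a quasi star, unless a fourth line makes them a star. -/
theorem outcome_of_three_lines (h : OffConic Z [a, b, c, d, e, f])
    (h1 : OnLine a L₁ ∧ OnLine b L₁ ∧ OnLine c L₁) (h2 : OnLine a L₂ ∧ OnLine d L₂ ∧ OnLine e L₂)
    (h3 : OnLine b L₃ ∧ OnLine d L₃ ∧ OnLine f L₃) : SixPointOutcome Z := by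
  obtain ⟨hd, -, -, -⟩ := h.not_onLine h1.1 h1.2.1 h1.2.2
  by_cases h4 : ∃ ℓ, OnLine c ℓ ∧ OnLine e ℓ ∧ OnLine f ℓ
  · obtain ⟨ℓ, h4⟩ := h4
    exact .inr (.inr ⟨a, b, c, d, e, f, L₁, L₂, L₃, ℓ, h.mem, h.nodup, by tauto, h2, h3, h4⟩)
  · refine .inr (.inl ⟨a, b, d, c, e, f, L₁, L₂, L₃, fun P hP => h.mem P ?_, ?_, by tauto, h2, h3,
      by simpa using h4⟩)
    · grind
    · have := h.nodup
      grind

variable [IsAlgClosed K] [CharZero K]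

theorem outcome_of_two_lines (h : OffConic Z [a, b, c, d, e, f])
    (h1 : OnLine a L₁ ∧ OnLine b L₁ ∧ OnLine c L₁)
    (h2 : OnLine a L₂ ∧ OnLine d L₂ ∧ OnLine e L₂) : SixPointOutcome Z := by
  have hne := h.nodup
  by_cases k1 : ∃ ℓ, OnLine b ℓ ∧ OnLine d ℓ ∧ OnLine f ℓ
  · obtain ⟨ℓ, k1⟩ := k1
    exact outcome_of_three_lines h h1 h2 k1
  by_cases k2 : ∃ ℓ, OnLine b ℓ ∧ OnLine e ℓ ∧ OnLine f ℓ
  · obtain ⟨ℓ, k2⟩ := k2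
    exact outcome_of_three_lines (h.reorder [0, 1, 2, 4, 3, 5] (by decide)) h1
      ⟨h2.1, h2.2.2, h2.2.1⟩ k2
  by_cases k3 : ∃ ℓ, OnLine c ℓ ∧ OnLine d ℓ ∧ OnLine f ℓ
  · obtain ⟨ℓ, k3⟩ := k3
    exact outcome_of_three_lines (h.reorder [0, 2, 1, 3, 4, 5] (by decide))
      ⟨h1.1, h1.2.2, h1.2.1⟩ h2 k3
  by_cases k4 : ∃ ℓ, OnLine c ℓ ∧ OnLine e ℓ ∧ OnLine f ℓ
  · obtain ⟨ℓ, k4⟩ := k4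
    exact outcome_of_three_lines (h.reorder [0, 2, 1, 4, 3, 5] (by decide))
      ⟨h1.1, h1.2.2, h1.2.1⟩ ⟨h2.1, h2.2.2, h2.2.1⟩ k4
  -- now `b`, `c`, `d`, `e`, `f` are in general position, and `f` is on neither line
  obtain ⟨hd, he, hf, -⟩ := h.not_onLine h1.1 h1.2.1 h1.2.2
  have hf2 : ¬ OnLine f L₂ := ((h.reorder [0, 3, 4, 1, 2, 5] (by decide)).not_onLine
    h2.1 h2.2.1 h2.2.2).2.2.1
  have h' : OffConic Z [f, b, c, d, e, a] := h.reorder [5, 1, 2, 3, 4, 0] (by decide)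
  obtain ⟨M, hM⟩ := exists_line (P := f) (Q := a) (by grind)
  push Not at k1 k2 k3 k4
  refine .inl (degreeBound_conic h'.mem h'.nodup h'.eq_zero hM.1 hM.2 ?_ fun ℓ => ?_)
  · grind [eq_or_eq_of_onLine]
  · grind [eq_or_eq_of_onLine]

theorem outcome_of_one_line (h : OffConic Z [a, b, c, d, e, f])
    (h1 : OnLine a L₁ ∧ OnLine b L₁ ∧ OnLine c L₁) : SixPointOutcome Z := by
  have hne := h.nodup
  -- a second line with three of the points contains one of `a`, `b`, `c` and two of `d`, `e`, `f`
  by_cases k1 : ∃ ℓ, OnLine a ℓ ∧ OnLine d ℓ ∧ OnLine e ℓ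
  · obtain ⟨ℓ, k⟩ := k1
    exact outcome_of_two_lines (h.reorder [0, 1, 2, 3, 4, 5] (by decide)) h1 k
  by_cases k2 : ∃ ℓ, OnLine a ℓ ∧ OnLine d ℓ ∧ OnLine f ℓ
  · obtain ⟨ℓ, k⟩ := k2
    exact outcome_of_two_lines (h.reorder [0, 1, 2, 3, 5, 4] (by decide)) h1 k
  by_cases k3 : ∃ ℓ, OnLine a ℓ ∧ OnLine e ℓ ∧ OnLine f ℓ
  · obtain ⟨ℓ, k⟩ := k3
    exact outcome_of_two_lines (h.reorder [0, 1, 2, 4, 5, 3] (by decide)) h1 k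
  by_cases k4 : ∃ ℓ, OnLine b ℓ ∧ OnLine d ℓ ∧ OnLine e ℓ
  · obtain ⟨ℓ, k⟩ := k4
    exact outcome_of_two_lines (h.reorder [1, 0, 2, 3, 4, 5] (by decide)) ⟨h1.2.1, h1.1, h1.2.2⟩ k
  by_cases k5 : ∃ ℓ, OnLine b ℓ ∧ OnLine d ℓ ∧ OnLine f ℓ
  · obtain ⟨ℓ, k⟩ := k5
    exact outcome_of_two_lines (h.reorder [1, 0, 2, 3, 5, 4] (by decide)) ⟨h1.2.1, h1.1, h1.2.2⟩ k
  by_cases k6 : ∃ ℓ, OnLine b ℓ ∧ OnLine e ℓ ∧ OnLine f ℓ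
  · obtain ⟨ℓ, k⟩ := k6
    exact outcome_of_two_lines (h.reorder [1, 0, 2, 4, 5, 3] (by decide)) ⟨h1.2.1, h1.1, h1.2.2⟩ k
  by_cases k7 : ∃ ℓ, OnLine c ℓ ∧ OnLine d ℓ ∧ OnLine e ℓ
  · obtain ⟨ℓ, k⟩ := k7
    exact outcome_of_two_lines (h.reorder [2, 0, 1, 3, 4, 5] (by decide)) ⟨h1.2.2, h1.1, h1.2.1⟩ k
  by_cases k8 : ∃ ℓ, OnLine c ℓ ∧ OnLine d ℓ ∧ OnLine f ℓ
  · obtain ⟨ℓ, k⟩ := k8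
    exact outcome_of_two_lines (h.reorder [2, 0, 1, 3, 5, 4] (by decide)) ⟨h1.2.2, h1.1, h1.2.1⟩ k
  by_cases k9 : ∃ ℓ, OnLine c ℓ ∧ OnLine e ℓ ∧ OnLine f ℓ
  · obtain ⟨ℓ, k⟩ := k9
    exact outcome_of_two_lines (h.reorder [2, 0, 1, 4, 5, 3] (by decide)) ⟨h1.2.2, h1.1, h1.2.1⟩ k
  -- now the given line is the only one, and omitting its point `a` leaves general position
  obtain ⟨hd, he, hf, hdef⟩ := h.not_onLine h1.1 h1.2.1 h1.2.2
  have h' : OffConic Z [d, b, c, e, f, a] := h.reorder [3, 1, 2, 4, 5, 0] (by decide)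
  obtain ⟨M, hM⟩ := exists_line (P := d) (Q := a) (by grind)
  push Not at k1 k2 k3 k4 k5 k6 k7 k8 k9
  refine .inl (degreeBound_conic h'.mem h'.nodup h'.eq_zero hM.1 hM.2 ?_ fun ℓ => ?_)
  · grind [eq_or_eq_of_onLine]
  · grind [eq_or_eq_of_onLine]

theorem outcome_of_offConic (h : OffConic Z [a, b, c, d, e, f]) : SixPointOutcome Z := by
  have hne := h.nodup
  by_cases hk : ∃ (i j k l m n : Fin 6) (ℓ : Plane K), [i, j, k, l, m, n].Perm (List.finRange 6) ∧
      OnLine (![a, b, c, d, e, f] i) ℓ ∧ OnLine (![a, b, c, d, e, f] j) ℓ ∧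
      OnLine (![a, b, c, d, e, f] k) ℓ
  · obtain ⟨i, j, k, l, m, n, ℓ, hp, hℓ⟩ := hk
    exact outcome_of_one_line (h.reorder [i, j, k, l, m, n] hp) hℓ
  have key : ∀ i j k l m n : Fin 6, [i, j, k, l, m, n].Perm (List.finRange 6) → ∀ ℓ,
      ¬ (OnLine (![a, b, c, d, e, f] i) ℓ ∧ OnLine (![a, b, c, d, e, f] j) ℓ ∧
        OnLine (![a, b, c, d, e, f] k) ℓ) :=
    fun i j k l m n hp ℓ hℓ => hk ⟨i, j, k, l, m, n, ℓ, hp, hℓ⟩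
  clear hk
  -- the six points are in general position
  obtain ⟨M, hM⟩ := exists_line (P := a) (Q := f) (by
    simp only [List.nodup_cons, List.mem_cons, not_or] at hne
    exact hne.1.2.2.2.2.1)
  refine .inl (degreeBound_conic h.mem h.nodup h.eq_zero hM.1 hM.2
    ⟨fun hx => key 0 1 5 2 3 4 (by decide) M ⟨hM.1, hx, hM.2⟩,
      fun hx => key 0 2 5 1 3 4 (by decide) M ⟨hM.1, hx, hM.2⟩,
      fun hx => key 0 3 5 2 1 4 (by decide) M ⟨hM.1, hx, hM.2⟩,
      fun hx => key 0 4 5 2 3 1 (by decide) M ⟨hM.1, hx, hM.2⟩⟩ fun ℓ => ?_)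
  exact ⟨key 0 1 2 3 4 5 (by decide) ℓ, key 0 1 3 2 4 5 (by decide) ℓ,
    key 0 1 4 2 3 5 (by decide) ℓ, key 0 2 3 1 4 5 (by decide) ℓ,
    key 0 2 4 1 3 5 (by decide) ℓ, key 0 3 4 1 2 5 (by decide) ℓ,
    key 1 2 3 0 4 5 (by decide) ℓ, key 1 2 4 0 3 5 (by decide) ℓ,
    key 1 3 4 0 2 5 (by decide) ℓ, key 2 3 4 0 1 5 (by decide) ℓ⟩

end Classification

/-! ### Stars and quasi stars -/

section Stars

variable {Z : Finset (Plane K)} {v₁₂ v₁₃ v₂₃ q₁ q₂ q₃ a b c d e f x L₀ L₁ L₂ L₃ : Plane K}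

theorem IsQuasiStarIn.swap₁₂ (h : IsQuasiStarIn Z v₁₂ v₁₃ v₂₃ q₁ q₂ q₃ L₁ L₂ L₃) :
    IsQuasiStarIn Z v₁₂ v₂₃ v₁₃ q₂ q₁ q₃ L₂ L₁ L₃ := by
  obtain ⟨hm, hn, h1, h2, h3, h4⟩ := h
  simp only [List.nodup_cons, List.mem_cons, not_or] at hn
  refine ⟨fun P hP => hm P ?_, ?_, ?_, ?_, ?_, fun ℓ hℓ => h4 ℓ ⟨hℓ.2.1, hℓ.1, hℓ.2.2⟩⟩
  · simp only [List.mem_cons] at hP ⊢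
    grind
  · simp only [List.nodup_cons, List.mem_cons, not_or]
    grind
  all_goals grind [eq_or_eq_of_onLine]

theorem IsQuasiStarIn.swap₁₃ (h : IsQuasiStarIn Z v₁₂ v₁₃ v₂₃ q₁ q₂ q₃ L₁ L₂ L₃) :
    IsQuasiStarIn Z v₂₃ v₁₃ v₁₂ q₃ q₂ q₁ L₃ L₂ L₁ := by
  obtain ⟨hm, hn, h1, h2, h3, h4⟩ := h
  simp only [List.nodup_cons, List.mem_cons, not_or] at hn
  refine ⟨fun P hP => hm P ?_, ?_, ?_, ?_, ?_, fun ℓ hℓ => h4 ℓ ⟨hℓ.2.2, hℓ.2.1, hℓ.1⟩⟩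
  · simp only [List.mem_cons] at hP ⊢
    grind
  · simp only [List.nodup_cons, List.mem_cons, not_or]
    grind
  all_goals grind [eq_or_eq_of_onLine]

theorem IsQuasiStarIn.degreeBound [Infinite K]
    (h : IsQuasiStarIn Z v₁₂ v₁₃ v₂₃ q₁ q₂ q₃ L₁ L₂ L₃) : DegreeBound 9 4 Z := by
  obtain ⟨hm, hn, h1, h2, h3, h4⟩ := h
  have hn' := hn
  simp only [List.nodup_cons, List.mem_cons, not_or] at hn'
  obtain ⟨M₁₂, h12⟩ := exists_line (P := q₁) (Q := q₂) (by grind)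
  obtain ⟨M₁₃, h13⟩ := exists_line (P := q₁) (Q := q₃) (by grind)
  obtain ⟨M₂₃, h23⟩ := exists_line (P := q₂) (Q := q₃) (by grind)
  exact degreeBound_quasiStar hm hn h1 h2 h3 ⟨h12.1, h12.2, fun h => h4 _ ⟨h12.1, h12.2, h⟩⟩
    h13 h23

/-- The remaining lines, `L₁` and the line through `q₂` and `q₃`, may contain `x`. -/
theorem IsQuasiStarIn.degreeBound_of_not_onLine [Infinite K]
    (h : IsQuasiStarIn Z v₁₂ v₁₃ v₂₃ q₁ q₂ q₃ L₁ L₂ L₃) (hx : x ∈ Z)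
    (hxn : x ∉ [v₁₂, v₁₃, v₂₃, q₁, q₂, q₃]) (hx2 : ¬ OnLine x L₂) (hx3 : ¬ OnLine x L₃)
    (hx12 : ∀ ℓ, OnLine q₁ ℓ → OnLine q₂ ℓ → ¬ OnLine x ℓ)
    (hx13 : ∀ ℓ, OnLine q₁ ℓ → OnLine q₃ ℓ → ¬ OnLine x ℓ) : DegreeBound 145 64 Z := by
  obtain ⟨hm, hn, h1, h2, h3, h4⟩ := h
  have hn' := hn
  simp only [List.nodup_cons, List.mem_cons, not_or] at hn'
  obtain ⟨M₁₂, h12⟩ := exists_line (P := q₁) (Q := q₂) (by grind)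
  obtain ⟨M₁₃, h13⟩ := exists_line (P := q₁) (Q := q₃) (by grind)
  obtain ⟨M₂₃, h23⟩ := exists_line (P := q₂) (Q := q₃) (by grind)
  refine degreeBound_quasiStar_extra (x := x) (fun P hP => ?_) ?_ h1
    ⟨h2.1, h2.2.1, h2.2.2, hx2⟩ ⟨h3.1, h3.2.1, h3.2.2, hx3⟩
    ⟨h12.1, h12.2, fun h => h4 _ ⟨h12.1, h12.2, h⟩, hx12 _ h12.1 h12.2⟩
    ⟨h13.1, h13.2, hx13 _ h13.1 h13.2⟩ h23
  · rw [show [v₁₂, v₁₃, v₂₃, q₁, q₂, q₃, x] = [v₁₂, v₁₃, v₂₃, q₁, q₂, q₃] ++ [x] from rfl,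
      List.mem_append, List.mem_singleton] at hP
    rcases hP with hP | rfl
    exacts [hm P hP, hx]
  · exact List.nodup_append.2 ⟨hn, List.nodup_singleton x, fun y hy z hz hyz =>
      hxn (by rwa [← List.mem_singleton.1 hz, ← hyz])⟩

/-- A further point is a vertex neither of the triangle of the lines `L i` nor of that of the
points `q i`, so it lies on at most one side of each. If it lies on a side of both, then these have
no point `q i` in common, so that `IsQuasiStarIn.degreeBound_of_not_onLine` applies to one of the
orderings. -/
theorem IsQuasiStarIn.degreeBound_of_mem [Infinite K]
    (h : IsQuasiStarIn Z v₁₂ v₁₃ v₂₃ q₁ q₂ q₃ L₁ L₂ L₃) (hx : x ∈ Z)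
    (hxn : x ∉ [v₁₂, v₁₃, v₂₃, q₁, q₂, q₃]) : DegreeBound 145 64 Z := by
  have hxn₁₂ : x ∉ [v₁₂, v₂₃, v₁₃, q₂, q₁, q₃] := by
    simp only [List.mem_cons] at hxn ⊢; grind
  have hxn₁₃ : x ∉ [v₂₃, v₁₃, v₁₂, q₃, q₂, q₁] := by
    simp only [List.mem_cons] at hxn ⊢; grind
  have base := h.degreeBound_of_not_onLine hx hxn
  have base₁₂ := h.swap₁₂.degreeBound_of_not_onLine hx hxn₁₂
  have base₁₃ := h.swap₁₃.degreeBound_of_not_onLine hx hxn₁₃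
  clear hxn₁₂ hxn₁₃
  obtain ⟨-, hn, h1, h2, h3, h4⟩ := h
  simp only [List.nodup_cons, List.mem_cons, not_or] at hn hxn
  by_cases k1 : OnLine x L₁
  · apply base <;> grind [eq_or_eq_of_onLine]
  by_cases k2 : OnLine x L₂
  · apply base₁₂ <;> grind [eq_or_eq_of_onLine]
  by_cases k3 : OnLine x L₃
  · apply base₁₃ <;> grind [eq_or_eq_of_onLine]
  by_cases k4 : ∃ ℓ, OnLine q₁ ℓ ∧ OnLine q₂ ℓ ∧ OnLine x ℓ
  · obtain ⟨ℓ, k4⟩ := k4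
    apply base₁₃ <;> grind [eq_or_eq_of_onLine]
  by_cases k5 : ∃ ℓ, OnLine q₁ ℓ ∧ OnLine q₃ ℓ ∧ OnLine x ℓ
  · obtain ⟨ℓ, k5⟩ := k5
    apply base₁₂ <;> grind [eq_or_eq_of_onLine]
  apply base <;> grind

theorem DegreeBound.of_seven_thirds (h : DegreeBound 7 3 Z) : DegreeBound 145 64 Z := fun m => by
  have := h m
  omega

theorem IsStarIn.degreeBound_of_onLine [Infinite K] (h : IsStarIn Z a b c d e f L₀ L₁ L₂ L₃)
    (hx : x ∈ Z) (hxn : x ∉ [a, b, c, d, e, f]) (hxL : OnLine x L₀) : DegreeBound 145 64 Z := by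
  -- replacing `c` by `x` turns the star into a quasi star
  obtain ⟨hm, hn, h0, h1, h2, h3⟩ := h
  simp only [List.nodup_cons, List.mem_cons, not_or] at hn hxn
  have hq : IsQuasiStarIn Z a b d x e f L₀ L₁ L₂ := by
    refine ⟨fun P hP => ?_, ?_, ?_, h1, h2, fun ℓ hℓ => ?_⟩
    · simp only [List.mem_cons] at hm hP
      grind
    · simp only [List.nodup_cons, List.mem_cons, not_or]
      grind
    · exact ⟨h0.1, h0.2.1, hxL, h0.2.2.2⟩
    · grind [eq_or_eq_of_onLine]
  refine hq.degreeBound_of_mem (x := c) (hm c (by simp)) ?_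
  simp only [List.mem_cons, not_or]
  grind

theorem IsStarIn.permute (h : IsStarIn Z a b c d e f L₀ L₁ L₂ L₃) :
    IsStarIn Z a d e b c f L₁ L₀ L₂ L₃ ∧ IsStarIn Z b d f a c e L₂ L₀ L₁ L₃ ∧
      IsStarIn Z c e f a b d L₃ L₀ L₁ L₂ := by
  obtain ⟨hm, hn, h0, h1, h2, h3⟩ := h
  simp only [List.nodup_cons, List.mem_cons, not_or] at hm hn
  refine ⟨⟨?_, ?_, ?_, ?_, ?_, ?_⟩, ⟨?_, ?_, ?_, ?_, ?_, ?_⟩, ⟨?_, ?_, ?_, ?_, ?_, ?_⟩⟩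
  all_goals try simp only [List.nodup_cons, List.mem_cons, not_or]
  all_goals grind [eq_or_eq_of_onLine]

theorem IsStarIn.degreeBound_of_mem [Infinite K] (h : IsStarIn Z a b c d e f L₀ L₁ L₂ L₃)
    (hx : x ∈ Z) (hxn : x ∉ [a, b, c, d, e, f]) : DegreeBound 145 64 Z := by
  by_cases k0 : OnLine x L₀
  · exact h.degreeBound_of_onLine hx hxn k0
  by_cases k1 : OnLine x L₁
  · refine h.permute.1.degreeBound_of_onLine hx ?_ k1
    simp only [List.mem_cons] at hxn ⊢; grind
  by_cases k2 : OnLine x L₂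
  · refine h.permute.2.1.degreeBound_of_onLine hx ?_ k2
    simp only [List.mem_cons] at hxn ⊢; grind
  by_cases k3 : OnLine x L₃
  · refine h.permute.2.2.degreeBound_of_onLine hx ?_ k3
    simp only [List.mem_cons] at hxn ⊢; grind
  obtain ⟨hm, hn, h0, h1, h2, h3⟩ := h
  refine (degreeBound_star_extra (x := x) (fun P hP => ?_) ?_ ⟨h0.1, h0.2.1, h0.2.2.1, h0.2.2.2, k0⟩
    ⟨h1.1, h1.2.1, h1.2.2, k1⟩ ⟨h2.1, h2.2.1, h2.2.2, k2⟩
    ⟨h3.1, h3.2.1, h3.2.2, k3⟩).of_seven_thirds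
  · rw [show [a, b, c, d, e, f, x] = [a, b, c, d, e, f] ++ [x] from rfl,
      List.mem_append, List.mem_singleton] at hP
    rcases hP with hP | rfl
    exacts [hm P hP, hx]
  · exact List.nodup_append.2 ⟨hn, List.nodup_singleton x, fun y hy z hz hyz =>
      hxn (by rwa [← List.mem_singleton.1 hz, ← hyz])⟩

theorem IsQuasiStarIn.isQuasiStar (h : IsQuasiStarIn Z v₁₂ v₁₃ v₂₃ q₁ q₂ q₃ L₁ L₂ L₃)
    (hZ : ∀ x ∈ Z, x ∈ [v₁₂, v₁₃, v₂₃, q₁, q₂, q₃]) : IsQuasiStar 3 Z := by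
  obtain ⟨hm, hn, h1, h2, h3, h4⟩ := h
  simp only [List.nodup_cons, List.mem_cons, not_or] at hn hm hZ
  have hcross : ∀ P, IsCrossing ![L₁, L₂, L₃] P ↔ P = v₁₂ ∨ P = v₁₃ ∨ P = v₂₃ := by
    intro P
    simp [IsCrossing, Fin.exists_fin_succ]
    grind [eq_or_eq_of_onLine]
  refine ⟨![L₁, L₂, L₃], ![q₁, q₂, q₃], ⟨?_, ?_⟩, ?_, ?_, ?_⟩
  · have : [L₁, L₂, L₃].Nodup := by
      simp only [List.nodup_cons, List.mem_cons, not_or]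
      grind [eq_or_eq_of_onLine]
    exact List.nodup_ofFn.1 (by simpa using this)
  · rintro i j k hij hik hjk ⟨P, hP⟩
    have : OnLine P L₁ ∧ OnLine P L₂ ∧ OnLine P L₃ := by
      fin_cases i <;> fin_cases j <;> fin_cases k <;> simp at hij hik hjk hP <;> grind
    grind [eq_or_eq_of_onLine]
  · intro i
    rw [hcross]
    fin_cases i <;> simp <;> grind
  · rintro ⟨ℓ, hℓ⟩
    exact h4 ℓ ⟨hℓ 0, hℓ 1, hℓ 2⟩
  · intro P
    rw [hcross]
    simp [Fin.exists_fin_succ]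
    grind

theorem IsStarIn.isStar (h : IsStarIn Z a b c d e f L₀ L₁ L₂ L₃)
    (hZ : ∀ x ∈ Z, x ∈ [a, b, c, d, e, f]) : IsStar 4 Z := by
  obtain ⟨hm, hn, h0, h1, h2, h3⟩ := h
  simp only [List.nodup_cons, List.mem_cons, not_or] at hn hm hZ
  have n01 : L₀ ≠ L₁ := by grind
  have n02 : L₀ ≠ L₂ := by grind
  have n03 : L₀ ≠ L₃ := by grind [eq_or_eq_of_onLine]
  have n12 : L₁ ≠ L₂ := by grind [eq_or_eq_of_onLine]
  have n13 : L₁ ≠ L₃ := by grind [eq_or_eq_of_onLine]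
  have n23 : L₂ ≠ L₃ := by grind [eq_or_eq_of_onLine]
  refine ⟨![L₀, L₁, L₂, L₃], ⟨?_, ?_⟩, fun P => ?_⟩
  · have : [L₀, L₁, L₂, L₃].Nodup := by
      simp only [List.nodup_cons, List.mem_cons, not_or]
      grind
    exact List.nodup_ofFn.1 (by simpa using this)
  · rintro i j k hij hik hjk ⟨P, hP⟩
    have : (OnLine P L₀ ∧ OnLine P L₁ ∧ OnLine P L₂) ∨ (OnLine P L₀ ∧ OnLine P L₁ ∧ OnLine P L₃) ∨
        (OnLine P L₀ ∧ OnLine P L₂ ∧ OnLine P L₃) ∨ (OnLine P L₁ ∧ OnLine P L₂ ∧ OnLine P L₃) := by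
      clear hm hn h0 h1 h2 h3 hZ
      fin_cases i <;> fin_cases j <;> fin_cases k <;> simp at hij hik hjk hP <;> grind
    grind [eq_or_eq_of_onLine]
  · have hcross : IsCrossing ![L₀, L₁, L₂, L₃] P ↔
        P = a ∨ P = b ∨ P = c ∨ P = d ∨ P = e ∨ P = f := by
      have ha := fun h h' => (eq_or_eq_of_onLine (P := P) h h0.1 h' h1.1).resolve_right n01
      have hb := fun h h' => (eq_or_eq_of_onLine (P := P) h h0.2.1 h' h2.1).resolve_right n02
      have hc := fun h h' => (eq_or_eq_of_onLine (P := P) h h0.2.2.1 h' h3.1).resolve_right n03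
      have hd := fun h h' => (eq_or_eq_of_onLine (P := P) h h1.2.1 h' h2.2.1).resolve_right n12
      have he := fun h h' => (eq_or_eq_of_onLine (P := P) h h1.2.2 h' h3.2.1).resolve_right n13
      have hf := fun h h' => (eq_or_eq_of_onLine (P := P) h h2.2.2 h' h3.2.2).resolve_right n23
      clear hn hm hZ
      simp [IsCrossing, Fin.exists_fin_succ]
      grind (splits := 30)
    rw [hcross]
    grind

theorem exists_point {ℓ ℓ' : Plane K} (h : ℓ ≠ ℓ') : ∃ P : Plane K, OnLine P ℓ ∧ OnLine P ℓ' := by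
  classical
  exact ⟨_, Projectivization.cross_orthogonal_left h, Projectivization.cross_orthogonal_right h⟩

theorem IsStar.exists_isStarIn (h : IsStar 4 Z) : ∃ a b c d e f L₀ L₁ L₂ L₃,
    IsStarIn Z a b c d e f L₀ L₁ L₂ L₃ ∧ ∀ x ∈ Z, x ∈ [a, b, c, d, e, f] := by
  obtain ⟨L, ⟨hL, hgen⟩, hZ⟩ := h
  have hex : ∀ i j : Fin 4, i ≠ j → ∃ P, OnLine P (L i) ∧ OnLine P (L j) :=
    fun i j hij => exists_point (hL.ne hij)
  obtain ⟨a, ha⟩ := hex 0 1 (by decide)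
  obtain ⟨b, hb⟩ := hex 0 2 (by decide)
  obtain ⟨c, hc⟩ := hex 0 3 (by decide)
  obtain ⟨d, hd⟩ := hex 1 2 (by decide)
  obtain ⟨e, he⟩ := hex 1 3 (by decide)
  obtain ⟨f, hf⟩ := hex 2 3 (by decide)
  have h012 : ∀ P, ¬ (OnLine P (L 0) ∧ OnLine P (L 1) ∧ OnLine P (L 2)) :=
    fun P hP => hgen 0 1 2 (by decide) (by decide) (by decide) ⟨P, hP⟩
  have h013 : ∀ P, ¬ (OnLine P (L 0) ∧ OnLine P (L 1) ∧ OnLine P (L 3)) :=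
    fun P hP => hgen 0 1 3 (by decide) (by decide) (by decide) ⟨P, hP⟩
  have h023 : ∀ P, ¬ (OnLine P (L 0) ∧ OnLine P (L 2) ∧ OnLine P (L 3)) :=
    fun P hP => hgen 0 2 3 (by decide) (by decide) (by decide) ⟨P, hP⟩
  have h123 : ∀ P, ¬ (OnLine P (L 1) ∧ OnLine P (L 2) ∧ OnLine P (L 3)) :=
    fun P hP => hgen 1 2 3 (by decide) (by decide) (by decide) ⟨P, hP⟩
  have n01 : L 0 ≠ L 1 := hL.ne (by decide)
  have n02 : L 0 ≠ L 2 := hL.ne (by decide)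
  have n03 : L 0 ≠ L 3 := hL.ne (by decide)
  have n12 : L 1 ≠ L 2 := hL.ne (by decide)
  have n13 : L 1 ≠ L 3 := hL.ne (by decide)
  have n23 : L 2 ≠ L 3 := hL.ne (by decide)
  refine ⟨a, b, c, d, e, f, L 0, L 1, L 2, L 3, ⟨?_, ?_, ?_, ?_, ?_, ?_⟩, ?_⟩
  · intro P hP
    rw [hZ]
    simp only [List.mem_cons, List.not_mem_nil, or_false] at hP
    rcases hP with rfl | rfl | rfl | rfl | rfl | rfl
    exacts [⟨0, 1, by decide, ha⟩, ⟨0, 2, by decide, hb⟩, ⟨0, 3, by decide, hc⟩,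
      ⟨1, 2, by decide, hd⟩, ⟨1, 3, by decide, he⟩, ⟨2, 3, by decide, hf⟩]
  · clear hZ hgen hex n01 n02 n03 n12 n13 n23 hL
    simp only [List.nodup_cons, List.mem_cons, List.not_mem_nil, not_or, not_false_eq_true,
      List.nodup_nil, and_true]
    refine ⟨⟨?_, ?_, ?_, ?_, ?_⟩, ⟨?_, ?_, ?_, ?_⟩, ⟨?_, ?_, ?_⟩, ⟨?_, ?_⟩, ?_⟩ <;> grind
  · grind
  · grind
  · grind
  · grind
  · intro P hP
    obtain ⟨i, j, hij, h⟩ := (hZ P).1 hP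
    clear hZ hgen hex
    have ka := fun h h' => (eq_or_eq_of_onLine (P := P) h ha.1 h' ha.2).resolve_right n01
    have kb := fun h h' => (eq_or_eq_of_onLine (P := P) h hb.1 h' hb.2).resolve_right n02
    have kc := fun h h' => (eq_or_eq_of_onLine (P := P) h hc.1 h' hc.2).resolve_right n03
    have kd := fun h h' => (eq_or_eq_of_onLine (P := P) h hd.1 h' hd.2).resolve_right n12
    have ke := fun h h' => (eq_or_eq_of_onLine (P := P) h he.1 h' he.2).resolve_right n13
    have kf := fun h h' => (eq_or_eq_of_onLine (P := P) h hf.1 h' hf.2).resolve_right n23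
    clear ha hb hc hd he hf h012 h013 h023 h123 n01 n02 n03 n12 n13 n23
    simp only [List.mem_cons, List.not_mem_nil, or_false]
    fin_cases i <;> fin_cases j <;> simp at hij h <;> grind

end Stars

/-! ### The Waldschmidt constant -/

section Waldschmidt

variable {Z : Finset (Plane K)}

/-- The classification of the sets that are not contained in a conic. Note `145 / 64 > 9 / 4`. -/
theorem degreeBound_or_isQuasiStar_or_isStar [IsAlgClosed K] [CharZero K] (hZ : ¬ InConic Z) :
    DegreeBound 145 64 Z ∨ (IsQuasiStar 3 Z ∧ DegreeBound 9 4 Z) ∨ IsStar 4 Z := by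
  obtain ⟨a, b, c, d, e, f, h⟩ := exists_offConic hZ
  rcases outcome_of_offConic h with h | ⟨v₁₂, v₁₃, v₂₃, q₁, q₂, q₃, L₁, L₂, L₃, h⟩ |
    ⟨a, b, c, d, e, f, L₀, L₁, L₂, L₃, h⟩
  · exact .inl h.of_seven_thirds
  · by_cases hx : ∀ x ∈ Z, x ∈ [v₁₂, v₁₃, v₂₃, q₁, q₂, q₃]
    · exact .inr (.inl ⟨h.isQuasiStar hx, h.degreeBound⟩)
    · push Not at hx
      obtain ⟨x, hx, hxn⟩ := hx
      exact .inl (h.degreeBound_of_mem hx hxn)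
  · by_cases hx : ∀ x ∈ Z, x ∈ [a, b, c, d, e, f]
    · exact .inr (.inr (h.isStar hx))
    · push Not at hx
      obtain ⟨x, hx, hxn⟩ := hx
      exact .inl (h.degreeBound_of_mem hx hxn)

theorem mem_pointIdeal {P : Plane K} {F : MvPolynomial (Fin 3) K} {d : ℕ} (hF : F.IsHomogeneous d)
    (h : MvPolynomial.eval P.rep F = 0) : F ∈ pointIdeal P :=
  Ideal.subset_span ⟨⟨d, hF⟩, h⟩

/-- Powers of a form that vanishes to order `k` at the points of `Z` bound the initial degrees. -/
theorem initialDegree_symbolicPower_le {F : MvPolynomial (Fin 3) K} {d m k : ℕ} (hF0 : F ≠ 0)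
    (hF : F.IsHomogeneous d) (h : ∀ P ∈ Z, F ∈ pointIdeal P ^ k) :
    initialDegree (symbolicPower Z (k * m)) ≤ d * m := by
  refine Nat.sInf_le ⟨F ^ m, ?_, pow_ne_zero _ hF0, hF.pow m⟩
  simp only [symbolicPower, Ideal.mem_iInf]
  intro P hP
  rw [pow_mul]
  exact Ideal.pow_mem_pow (h P hP) m

theorem InLine.initialDegree_le (hZ : InLine Z) (m : ℕ) :
    initialDegree (symbolicPower Z m) ≤ m := by
  obtain ⟨ℓ, hℓ⟩ := hZ
  have := initialDegree_symbolicPower_le (m := m) (k := 1) (lin_ne_zero ℓ.rep_nonzero)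
    (isHomogeneous_lin ℓ.rep) fun P hP =>
      (pow_one (pointIdeal P)).symm ▸ mem_pointIdeal (isHomogeneous_lin _)
        (onLine_iff_eval.1 (hℓ P hP))
  simpa using this

theorem InConic.initialDegree_le (hZ : InConic Z) (m : ℕ) :
    initialDegree (symbolicPower Z m) ≤ 2 * m := by
  obtain ⟨F, hF0, hF, h⟩ := hZ
  have := initialDegree_symbolicPower_le (m := m) (k := 1) hF0 hF fun P hP =>
      (pow_one (pointIdeal P)).symm ▸ mem_pointIdeal hF (h P hP)
  simpa using this

/-- The product of the four lines of a star has multiplicity `2` at its points. -/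
theorem IsStar.initialDegree_le (hZ : IsStar 4 Z) (m : ℕ) :
    initialDegree (symbolicPower Z (2 * m)) ≤ 4 * m := by
  obtain ⟨L, -, hL⟩ := hZ
  refine initialDegree_symbolicPower_le (F := ∏ i, lin (L i).rep)
    (Finset.prod_ne_zero_iff.2 fun i _ => lin_ne_zero (L i).rep_nonzero) ?_ fun P hP => ?_
  · simpa using MvPolynomial.IsHomogeneous.prod Finset.univ (fun i => lin (L i).rep) (fun _ => 1)
      fun i _ => isHomogeneous_lin _
  · obtain ⟨i, j, hij, hi, hj⟩ := (hL P).1 hP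
    refine Ideal.mem_of_dvd _ (Finset.prod_dvd_prod_of_subset {i, j} _ _ (Finset.subset_univ _)) ?_
    rw [Finset.prod_pair hij, pow_two]
    exact Ideal.mul_mem_mul (mem_pointIdeal (isHomogeneous_lin _) (onLine_iff_eval.1 hi))
      (mem_pointIdeal (isHomogeneous_lin _) (onLine_iff_eval.1 hj))

theorem waldschmidt_le {m : ℕ} (hm : 1 ≤ m) :
    waldschmidt Z ≤ (initialDegree (symbolicPower Z m) : ℝ) / m := by
  refine csInf_le ⟨0, ?_⟩ ⟨m, hm, rfl⟩
  rintro _ ⟨m, -, rfl⟩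
  positivity

theorem DegreeBound.le_waldschmidt {a b : ℕ} (h : DegreeBound a b Z) (hb : 0 < b) :
    (a : ℝ) / b ≤ waldschmidt Z := by
  refine le_csInf (Set.nonempty_Ici.image _) ?_
  rintro _ ⟨m, hm, rfl⟩
  have hm' : (0 : ℝ) < m := by exact_mod_cast hm
  rw [div_le_div_iff₀ (by exact_mod_cast hb) hm', mul_comm (initialDegree _ : ℝ)]
  exact_mod_cast h m

theorem degreeBound_of_nonempty (hZ : Z.Nonempty) : DegreeBound 1 1 Z := fun m => by
  obtain ⟨P, hP⟩ := hZ
  obtain ⟨F, hF, hF0, hFd⟩ := initialDegree_spec Z m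
  have h1 := le_ord_of_mem_symbolicPower hP hF0 hF
  have h2 := ord_le_of_isHomogeneous P.rep hFd
  omega

theorem InLine.waldschmidt_eq (hZ : Z.Nonempty) (h : InLine Z) : waldschmidt Z = 1 := by
  refine le_antisymm ((waldschmidt_le le_rfl).trans ?_) ?_
  · simpa using h.initialDegree_le 1
  · simpa using (degreeBound_of_nonempty hZ).le_waldschmidt one_pos

theorem InConic.waldschmidt_le_two (h : InConic Z) : waldschmidt Z ≤ 2 := by
  refine (waldschmidt_le le_rfl).trans ?_
  simpa using (Nat.cast_le (α := ℝ)).2 (h.initialDegree_le 1)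

theorem IsStar.waldschmidt_eq [Infinite K] (h : IsStar 4 Z) : waldschmidt Z = 2 := by
  refine le_antisymm ((waldschmidt_le one_le_two).trans ?_) ?_
  · rw [div_le_iff₀ (by norm_num)]
    have := (Nat.cast_le (α := ℝ)).2 (h.initialDegree_le 1)
    norm_num at this ⊢
    exact this
  · obtain ⟨a, b, c, d, e, f, L₀, L₁, L₂, L₃, h, -⟩ := h.exists_isStarIn
    simpa using (degreeBound_star h.mem h.nodup h.line₀ h.line₁ h.line₂ h.line₃).le_waldschmidt
      one_pos

theorem IsStar.card_eq (h : IsStar 4 Z) : Z.card = 6 := by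
  classical
  obtain ⟨a, b, c, d, e, f, L₀, L₁, L₂, L₃, h, hZ⟩ := h.exists_isStarIn
  have : Z = [a, b, c, d, e, f].toFinset := by
    ext P
    rw [List.mem_toFinset]
    exact ⟨hZ P, h.mem P⟩
  rw [this, List.toFinset_card_of_nodup h.nodup]
  rfl

theorem inConic_or_isStar_of_waldschmidt_lt [IsAlgClosed K] [CharZero K]
    (h : waldschmidt Z < 9 / 4) : InConic Z ∨ IsStar 4 Z := by
  by_cases hc : InConic Z
  · exact .inl hc
  rcases degreeBound_or_isQuasiStar_or_isStar hc with h' | ⟨-, h'⟩ | h'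
  · have := h'.le_waldschmidt (by norm_num)
    norm_num at this
    linarith
  · have := h'.le_waldschmidt (by norm_num)
    norm_num at this
    linarith
  · exact .inr h'

theorem isQuasiStar_of_initialDegree_eq [IsAlgClosed K] [CharZero K] {m : ℕ} (hm : 1 ≤ m)
    (h : 4 * initialDegree (symbolicPower Z m) = 9 * m) : IsQuasiStar 3 Z := by
  have hc : ¬ InConic Z := fun hc => by
    have := hc.initialDegree_le m
    omega
  rcases degreeBound_or_isQuasiStar_or_isStar hc with h' | ⟨h', -⟩ | h'
  · have := h' m
    omega
  · exact h'
  · -- `m` is even, so powers of the product of the four lines give `α ≤ 2 * m`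
    obtain ⟨k, rfl⟩ : ∃ k, m = 2 * k := ⟨m / 2, by omega⟩
    have := h'.initialDegree_le k
    omega

end Waldschmidt

end PlanarPoints

end

theorem mainTheorem1 {K : Type*} [Field K] [IsAlgClosed K] [CharZero K]
    (Z : Finset (PlanarPoints.Plane K)) (hZ : Z.Nonempty) :
    (PlanarPoints.waldschmidt Z < 9 / 4 →
      PlanarPoints.InLine Z ∨ PlanarPoints.InConic Z ∨
        (PlanarPoints.IsStar 4 Z ∧ Z.card = 6)) ∧
    (PlanarPoints.InLine Z → PlanarPoints.waldschmidt Z = 1) ∧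
    (PlanarPoints.InConic Z → PlanarPoints.waldschmidt Z ≤ 2) ∧
    (PlanarPoints.IsStar 4 Z → PlanarPoints.waldschmidt Z = 2 ∧ Z.card = 6) ∧
    ((∃ m : ℕ, 1 ≤ m ∧
        (PlanarPoints.initialDegree (PlanarPoints.symbolicPower Z m) : ℝ) / m = 9 / 4) →
      PlanarPoints.IsQuasiStar 3 Z) := by
  refine ⟨fun h => .inr ?_, fun h => h.waldschmidt_eq hZ, fun h => h.waldschmidt_le_two,
    fun h => ⟨h.waldschmidt_eq, h.card_eq⟩, ?_⟩
  · exact (PlanarPoints.inConic_or_isStar_of_waldschmidt_lt h).imp_right fun h => ⟨h, h.card_eq⟩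
  · rintro ⟨m, hm, h⟩
    refine PlanarPoints.isQuasiStar_of_initialDegree_eq hm ?_
    have hm' : (m : ℝ) ≠ 0 := by positivity
    rw [div_eq_div_iff hm' (by norm_num), mul_comm] at h
    exact_mod_cast h
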